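/- Let $0<\beta<\tfrac12$. There is $N_\beta\ge 1$ depending only on $\beta$, and for all constants $A_1,A_2>0$ there is $C>0$ depending only on $\beta,A_1,A_2$, such that the following holds. Let $q\ge 2$ be any prime power, let $\mathcal{M}$ be the set of monic polynomials in $\mathbb{F}_q[t]$, and let $g:\mathcal{M}\to[0,\infty)$ be multiplicative (that is, $g(1)=1$ and $g(FG)=g(F)g(G)$ for coprime $F,G\in\mathcal{M}$), with $$g(P^\ell)\le A_1^{\ell}\quad\text{for all monic irreducible } P \text{ and all integers } \ell\ge 1,\qquad g(F)\le A_2\,2^{(\beta/24)\deg F}\quad\text{for all } F\in\mathcal{M}.$$ Let $N\ge N_\beta$ and $h$ be integers with $\beta N<h\le N-1$, let $A\in\mathcal{M}$ have degree $N$, and put $\mathcal{I}(A,h)=\{F\in\mathcal{M}:\deg F=N,\ \deg(F-A)\le h\}$ (with $\deg 0=-\infty$). Then $$\sum_{F\in\mathcal{I}(A,h)}g(F)\;\le\; C\,\frac{q^{h+1}}{N}\exp\Big(\sum_{\substack{P \text{ monic irreducible}\\ \deg P\le N}}\frac{g(P)}{q^{\deg P}}\Big).$$ -/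

import Mathlib

open Polynomial

/-- The interval of radius `h` around `A` in `K[t]`: the monic polynomials `G` with
`deg G = deg A` and `deg (A - G) ≤ h` (`degree`, so that the zero polynomial has degree `⊥`). -/
def polyInterval {K : Type*} [Field K] (A : K[X]) (h : ℕ) : Set K[X] :=
  {G | G.Monic ∧ G.natDegree = A.natDegree ∧ (A - G).degree ≤ (h : WithBot ℕ)}

/-- The primes of `K[t]` (monic irreducible polynomials) of degree at most `N`. -/
def primesUpTo (K : Type*) [Field K] (N : ℕ) : Set K[X] :=
  {P | P.Monic ∧ Irreducible P ∧ P.natDegree ≤ N}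

theorem finite_natDegree_le (K : Type*) [Field K] [Finite K] (N : ℕ) :
    {G : K[X] | G.natDegree ≤ N}.Finite := by
  apply Set.Finite.of_finite_image (f := fun G : K[X] => fun i : Fin (N + 1) => G.coeff i)
  · exact Set.toFinite _
  · intro G hG H hH hGH
    ext i
    by_cases hi : i < N + 1
    · exact congrFun hGH ⟨i, hi⟩
    · have hG' : G.natDegree ≤ N := hG
      have hH' : H.natDegree ≤ N := hH
      rw [coeff_eq_zero_of_natDegree_lt (by omega), coeff_eq_zero_of_natDegree_lt (by omega)]

theorem polyInterval_finite {K : Type*} [Field K] [Finite K] (A : K[X]) (h : ℕ) :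
    (polyInterval A h).Finite :=
  (finite_natDegree_le K A.natDegree).subset fun _ hG => hG.2.1.le

theorem primesUpTo_finite (K : Type*) [Field K] [Finite K] (N : ℕ) :
    (primesUpTo K N).Finite :=
  (finite_natDegree_le K N).subset fun _ hP => hP.2.2

/-- `g` is a non-negative multiplicative function on monic polynomials with
`g (P ^ l) ≤ A₁ ^ l` for all primes `P` and `l ≥ 1`, and `g F ≤ A₂ * 2 ^ (δ * deg F)` for all
monic `F`. Only the values of `g` at monic polynomials are constrained. -/
structure IsShiuFunction {K : Type*} [Field K] (δ A₁ A₂ : ℝ) (g : K[X] → ℝ) : Prop where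
  nonneg : ∀ F : K[X], F.Monic → 0 ≤ g F
  map_one : g 1 = 1
  map_mul : ∀ F G : K[X], F.Monic → G.Monic → IsCoprime F G → g (F * G) = g F * g G
  prime_pow_le : ∀ P : K[X], P.Monic → Irreducible P → ∀ l : ℕ, 1 ≤ l → g (P ^ l) ≤ A₁ ^ l
  le_two_rpow : ∀ F : K[X], F.Monic → g F ≤ A₂ * (2 : ℝ) ^ (δ * (F.natDegree : ℝ))

/-! This is Shiu's method. Put `z = ⌊h / 4⌋`, which is at least `β N / 5`. The prime powers of `F`
are collected in order of increasing degree of the prime until the next one, a power of `P`, would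
push the degree past `2 z`. This writes `F = b c` with `b`, `c` coprime, `deg b ≤ 2 z`, and `deg P`
separating the prime degrees of `b` from those of `c` (`exists_isCut`). For fixed `b`, the cofactor
`c` runs over a shorter ball and has no small primes, so Selberg's sieve (`card_rough_le`) saves the
factor `N`. It also has at most `N / deg P` prime factors, which bounds `g c`. The remaining sum of
`g b / |b|` is at most an Euler product, and this is the exponential in the theorem.

Four cases cover all `F`. If `deg P > z`, then `g c` is bounded and the argument above finishes. If
`deg P ≤ z` and `deg b ≤ z`, then `F` is divisible by a proper prime power of degree exceeding `z`.
If `deg P` is bounded and `deg b ≥ z`, then `F` has a large divisor composed of boundedly small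
primes. In these two cases such `F` are exponentially rare in `z`, which beats the pointwise bound
`g F ≪ (7/6) ^ z`. Otherwise put `r = ⌊z / deg P⌋`. Here `g c` may be as large as `D ^ (r + 1)` with
`D` constant, but Rankin's trick applied to `deg b ≥ z` gains `(4 D ^ 2) ^ (-r)`, and the sum over
`r` converges. -/

section

variable {K : Type*} [Field K]

/-! ### Balls and exact counts of multiples -/

open Classical in
/-- The ball of polynomials `F` with `deg (F - A) < H`. -/
noncomputable def ball [Fintype K] (A : K[X]) (H : ℕ) : Finset K[X] :=
  (Finset.univ : Finset (Fin H → K)).image fun f => A + ((degreeLTEquiv K H).symm f : K[X])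

theorem card_ball [Fintype K] (A : K[X]) (H : ℕ) : (ball A H).card = Fintype.card K ^ H := by
  classical
  rw [ball, Finset.card_image_of_injective]
  · simp
  · intro f f' hf
    simpa using hf

theorem mem_ball_iff [Fintype K] {A F : K[X]} {H : ℕ} :
    F ∈ ball A H ↔ (F - A).degree < (H : WithBot ℕ) := by
  simp only [ball, Finset.mem_image, Finset.mem_univ, true_and]
  constructor
  · rintro ⟨f, rfl⟩
    rw [add_sub_cancel_left]
    exact mem_degreeLT.1 ((degreeLTEquiv K H).symm f).2
  · intro h
    refine ⟨degreeLTEquiv K H ⟨F - A, mem_degreeLT.2 h⟩, ?_⟩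
    simp

/-- The remainder of `A` modulo `d` has degree below `H`, so it does not affect membership and the
centre may be replaced by a multiple of `d`. -/
theorem mul_mem_ball_iff [Fintype K] {A d G : K[X]} {H : ℕ} (hd : d.Monic)
    (hdH : d.natDegree ≤ H) :
    d * G ∈ ball A H ↔ G ∈ ball (A /ₘ d) (H - d.natDegree) := by
  have hmod : (A %ₘ d).degree < (H : WithBot ℕ) :=
    (degree_modByMonic_lt A hd).trans_le (by
      rw [degree_eq_natDegree hd.ne_zero]; exact_mod_cast hdH)
  have hA : d * G - A = d * (G - A /ₘ d) - A %ₘ d := by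
    conv_lhs => rw [← modByMonic_add_div A d]
    ring
  rw [mem_ball_iff, mem_ball_iff, hA]
  have h1 : (d * (G - A /ₘ d) - A %ₘ d).degree < (H : WithBot ℕ) ↔
      (d * (G - A /ₘ d)).degree < (H : WithBot ℕ) := by
    constructor
    · intro h
      have := (degree_add_le (d * (G - A /ₘ d) - A %ₘ d) (A %ₘ d)).trans_lt (max_lt h hmod)
      simpa using this
    · intro h
      exact (degree_sub_le _ _).trans_lt (max_lt h hmod)
  rw [h1]
  by_cases h0 : G - A /ₘ d = 0
  · simp [h0]
  · rw [degree_mul, degree_eq_natDegree hd.ne_zero, degree_eq_natDegree h0]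
    norm_cast
    omega

open Classical in
theorem card_filter_dvd_ball [Fintype K] {A d : K[X]} {H : ℕ} (hd : d.Monic)
    (hdH : d.natDegree ≤ H) :
    ((ball A H).filter (d ∣ ·)).card = Fintype.card K ^ (H - d.natDegree) := by
  rw [← card_ball (A /ₘ d)]
  symm
  refine Finset.card_bij (fun G _ => d * G) ?_ ?_ ?_
  · intro G hG
    simpa using (mul_mem_ball_iff hd hdH).2 hG
  · intro G _ G' _ h
    exact mul_left_cancel₀ hd.ne_zero h
  · intro F hF
    obtain ⟨hF, G, rfl⟩ := Finset.mem_filter.1 hF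
    exact ⟨G, (mul_mem_ball_iff hd hdH).1 hF, rfl⟩

theorem one_lt_card_real (K : Type*) [Field K] [Fintype K] : (1 : ℝ) < Fintype.card K := by
  exact_mod_cast Fintype.one_lt_card

theorem two_le_card_real (K : Type*) [Field K] [Fintype K] : (2 : ℝ) ≤ Fintype.card K := by
  exact_mod_cast (Fintype.one_lt_card : 1 < Fintype.card K)

theorem card_real_pos (K : Type*) [Field K] [Fintype K] : (0 : ℝ) < Fintype.card K :=
  zero_lt_one.trans (one_lt_card_real K)

/-- The norm `q ^ deg F`. -/
noncomputable def qnorm [Fintype K] (F : K[X]) : ℝ := (Fintype.card K : ℝ) ^ F.natDegree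

theorem qnorm_pos [Fintype K] (F : K[X]) : 0 < qnorm F := pow_pos (card_real_pos K) _

theorem two_pow_le_qnorm [Fintype K] (F : K[X]) : 2 ^ F.natDegree ≤ qnorm F :=
  pow_le_pow_left₀ zero_le_two (two_le_card_real K) _

theorem one_lt_qnorm [Fintype K] {P : K[X]} (hP : Irreducible P) : 1 < qnorm P :=
  one_lt_pow₀ (one_lt_card_real K) hP.natDegree_pos.ne'

theorem qnorm_mul [Fintype K] {F G : K[X]} (hF : F.Monic) (hG : G.Monic) :
    qnorm (F * G) = qnorm F * qnorm G := by
  rw [qnorm, hF.natDegree_mul hG, pow_add]; rfl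

theorem qnorm_pow [Fintype K] {F : K[X]} (hF : F.Monic) (n : ℕ) :
    qnorm (F ^ n) = qnorm F ^ n := by
  rw [qnorm, hF.natDegree_pow, mul_comm, pow_mul]; rfl

theorem qnorm_prod [Fintype K] {D : Finset K[X]} (hD : ∀ P ∈ D, P.Monic) :
    qnorm (∏ P ∈ D, P) = ∏ P ∈ D, qnorm P := by
  simp only [qnorm]
  rw [natDegree_prod_of_monic _ _ hD, Finset.prod_pow_eq_pow_sum]

theorem card_filter_dvd_ball_real [Fintype K] {A d : K[X]} {H : ℕ} (hd : d.Monic)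
    (hdH : d.natDegree ≤ H) [DecidablePred (d ∣ ·)] :
    (((ball A H).filter (d ∣ ·)).card : ℝ) = (Fintype.card K : ℝ) ^ H / qnorm d := by
  have := card_filter_dvd_ball (A := A) hd hdH
  rw [eq_div_iff (qnorm_pos d).ne', qnorm]
  have h2 : ((ball A H).filter (d ∣ ·)).card = Fintype.card K ^ (H - d.natDegree) := by
    rw [← this]; congr
  rw [h2]
  push_cast
  rw [← pow_add, Nat.sub_add_cancel hdH]

theorem isCoprime_of_monic_irreducible {P Q : K[X]} (hP : P.Monic) (hP' : Irreducible P)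
    (hQ : Q.Monic) (hQ' : Irreducible Q) (h : P ≠ Q) : IsCoprime P Q := by
  rw [hP'.coprime_iff_not_dvd]
  intro hd
  exact h (eq_of_monic_of_associated hP hQ (hP'.associated_of_dvd hQ' hd))

theorem prod_dvd_iff_of_primes {D : Finset K[X]} (hD : ∀ P ∈ D, P.Monic ∧ Irreducible P)
    (F : K[X]) : (∏ P ∈ D, P) ∣ F ↔ ∀ P ∈ D, P ∣ F := by
  constructor
  · intro h P hP
    exact (Finset.dvd_prod_of_mem _ hP).trans h
  · intro h
    refine Finset.prod_dvd_of_coprime ?_ h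
    intro P hP Q hQ hPQ
    exact isCoprime_of_monic_irreducible (hD P hP).1 (hD P hP).2 (hD Q hQ).1 (hD Q hQ).2 hPQ

-- Expanding the product leaves indicators of divisibility by squarefree polynomials of degree at
-- most `H`. Their averages over the ball are exact, so divisibility by distinct primes behaves like
-- independent events, with no error term.
open Classical in
theorem sum_ball_prod [Fintype K] (A : K[X]) (H : ℕ) {U : Finset K[X]}
    (hU : ∀ P ∈ U, P.Monic ∧ Irreducible P) (hdeg : ∑ P ∈ U, P.natDegree ≤ H)
    (u v : K[X] → ℝ) :
    ∑ n ∈ ball A H, ∏ P ∈ U, (u P * (if P ∣ n then 1 else 0) + v P) =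
      (Fintype.card K : ℝ) ^ H * ∏ P ∈ U, (u P / qnorm P + v P) := by
  simp_rw [Finset.prod_add]
  rw [Finset.sum_comm, Finset.mul_sum]
  refine Finset.sum_congr rfl fun T hT => ?_
  have hTU := Finset.mem_powerset.1 hT
  have hT' : ∀ P ∈ T, P.Monic ∧ Irreducible P := fun P hP => hU P (hTU hP)
  have hTd : (∏ P ∈ T, P).natDegree ≤ H := by
    rw [natDegree_prod_of_monic _ _ fun P hP => (hT' P hP).1]
    exact (Finset.sum_le_sum_of_subset hTU).trans hdeg
  rw [← Finset.sum_mul, Finset.prod_div_distrib, ← qnorm_prod fun P hP => (hT' P hP).1]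
  simp_rw [Finset.prod_mul_distrib]
  rw [← Finset.mul_sum]
  have : ∀ n, (∏ P ∈ T, (if P ∣ n then (1 : ℝ) else 0)) =
      if (∏ P ∈ T, P) ∣ n then 1 else 0 := by
    intro n
    rw [Finset.prod_ite_zero, prod_dvd_iff_of_primes hT']
    simp
  simp_rw [this]
  rw [Finset.sum_boole, card_filter_dvd_ball_real
    (monic_prod_of_monic _ _ fun P hP => (hT' P hP).1) hTd]
  ring

/-! ### Selberg's sieve through Ramanujan sums -/

/-- The primes of degree at most `m`, as a finset. -/
noncomputable def primes (K : Type*) [Field K] [Finite K] (m : ℕ) : Finset K[X] :=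
  (primesUpTo_finite K m).toFinset

theorem mem_primes [Finite K] {m : ℕ} {P : K[X]} :
    P ∈ primes K m ↔ P.Monic ∧ Irreducible P ∧ P.natDegree ≤ m := by
  simp [primes, primesUpTo]

/-- Sets of primes whose product has degree at most `m`. -/
noncomputable def primeSets (K : Type*) [Field K] [Finite K] (m : ℕ) : Finset (Finset K[X]) :=
  (primes K m).powerset.filter fun D => ∑ P ∈ D, P.natDegree ≤ m

theorem mem_primeSets [Finite K] {m : ℕ} {D : Finset K[X]} :
    D ∈ primeSets K m ↔ (∀ P ∈ D, P.Monic ∧ Irreducible P) ∧ ∑ P ∈ D, P.natDegree ≤ m := by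
  simp only [primeSets, Finset.mem_filter, Finset.mem_powerset]
  constructor
  · rintro ⟨h1, h2⟩
    exact ⟨fun P hP => ⟨(mem_primes.1 (h1 hP)).1, (mem_primes.1 (h1 hP)).2.1⟩, h2⟩
  · rintro ⟨h1, h2⟩
    refine ⟨fun P hP => mem_primes.2 ⟨(h1 P hP).1, (h1 P hP).2, ?_⟩, h2⟩
    exact (Finset.single_le_sum (f := fun P : K[X] => P.natDegree)
      (fun _ _ => Nat.zero_le _) hP).trans h2

/-- The Selberg sum `∑ μ²(d) / φ(d)` over `deg d ≤ m`. -/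
noncomputable def selbergSum (K : Type*) [Field K] [Fintype K] (m : ℕ) : ℝ :=
  ∑ D ∈ primeSets K m, ∏ P ∈ D, 1 / (qnorm P - 1)

open Classical in
/-- The normalised Ramanujan sum attached to a set of primes. -/
noncomputable def ramanujan [Fintype K] (D : Finset K[X]) (n : K[X]) : ℝ :=
  ∏ P ∈ D, (1 - qnorm P * if P ∣ n then 1 else 0) / (qnorm P - 1)

-- Orthogonality: a local factor has mean zero, and its square has mean `1 / (|P| - 1)`. The
-- condition `2 * m ≤ H` makes independence exact for the primes of both sets together.
open Classical in
theorem sum_ball_ramanujan_mul [Fintype K] (A : K[X]) {m H : ℕ} (hm : 2 * m ≤ H)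
    {D E : Finset K[X]} (hD : D ∈ primeSets K m) (hE : E ∈ primeSets K m) :
    ∑ n ∈ ball A H, ramanujan D n * ramanujan E n =
      if D = E then (Fintype.card K : ℝ) ^ H * ∏ P ∈ D, 1 / (qnorm P - 1) else 0 := by
  obtain ⟨hD1, hD2⟩ := mem_primeSets.1 hD
  obtain ⟨hE1, hE2⟩ := mem_primeSets.1 hE
  have hU : ∀ P ∈ D ∪ E, P.Monic ∧ Irreducible P := by
    intro P hP
    rcases Finset.mem_union.1 hP with h | h
    exacts [hD1 P h, hE1 P h]
  have hdeg : ∑ P ∈ D ∪ E, P.natDegree ≤ H := by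
    have := Finset.sum_union_inter (s₁ := D) (s₂ := E) (f := fun P : K[X] => P.natDegree)
    omega
  -- Each local factor is affine in the indicator of `P ∣ n`. On `D ∩ E` the coefficients are those
  -- of its square; elsewhere they give `u P / qnorm P + v P = 0`.
  let u : K[X] → ℝ := fun P =>
    if P ∈ D ∩ E then (qnorm P ^ 2 - 2 * qnorm P) / (qnorm P - 1) ^ 2
    else - qnorm P / (qnorm P - 1)
  let v : K[X] → ℝ := fun P =>
    if P ∈ D ∩ E then 1 / (qnorm P - 1) ^ 2 else 1 / (qnorm P - 1)
  have key : ∀ n, ramanujan D n * ramanujan E n =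
      ∏ P ∈ D ∪ E, (u P * (if P ∣ n then 1 else 0) + v P) := by
    intro n
    have e1 : ramanujan D n = ∏ P ∈ D ∪ E, if P ∈ D then
        (1 - qnorm P * if P ∣ n then 1 else 0) / (qnorm P - 1) else 1 := by
      rw [Finset.prod_ite_mem, Finset.inter_eq_right.2 Finset.subset_union_left]; rfl
    have e2 : ramanujan E n = ∏ P ∈ D ∪ E, if P ∈ E then
        (1 - qnorm P * if P ∣ n then 1 else 0) / (qnorm P - 1) else 1 := by
      rw [Finset.prod_ite_mem, Finset.inter_eq_right.2 Finset.subset_union_right]; rfl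
    rw [e1, e2, ← Finset.prod_mul_distrib]
    refine Finset.prod_congr rfl fun P hP => ?_
    have h1 : qnorm P - 1 ≠ 0 := (sub_pos.2 (one_lt_qnorm (hU P hP).2)).ne'
    rcases Finset.mem_union.1 hP with h | h
    · by_cases h' : P ∈ E <;> by_cases hd : P ∣ n <;> simp [u, v, h, h', hd] <;> field_simp <;> ring
    · by_cases h' : P ∈ D <;> by_cases hd : P ∣ n <;> simp [u, v, h, h', hd] <;> field_simp <;> ring
  simp_rw [key]
  rw [sum_ball_prod A H hU hdeg]
  split_ifs with hDE
  · subst hDE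
    rw [Finset.union_self]
    congr 1
    refine Finset.prod_congr rfl fun P hP => ?_
    have h1 : qnorm P - 1 ≠ 0 := (sub_pos.2 (one_lt_qnorm (hD1 P hP).2)).ne'
    have h2 := (qnorm_pos P).ne'
    simp only [u, v, Finset.inter_self, hP, if_true]
    field_simp
    ring
  · obtain ⟨P, hP, hP'⟩ : ∃ P ∈ D ∪ E, P ∉ D ∩ E := by
      by_contra! hcon
      refine hDE (Finset.Subset.antisymm ?_ ?_) <;> intro P hP
      · exact (Finset.mem_inter.1 (hcon P (Finset.mem_union_left _ hP))).2
      · exact (Finset.mem_inter.1 (hcon P (Finset.mem_union_right _ hP))).1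
    rw [Finset.prod_eq_zero hP, mul_zero]
    have h1 : qnorm P - 1 ≠ 0 := (sub_pos.2 (one_lt_qnorm (hU P hP).2)).ne'
    have h2 := (qnorm_pos P).ne'
    simp only [u, v, hP', if_false]
    field_simp
    ring

theorem selbergSum_pos (K : Type*) [Field K] [Fintype K] (m : ℕ) : 0 < selbergSum K m := by
  refine Finset.sum_pos (fun D hD => Finset.prod_pos fun P hP => ?_) ⟨∅, ?_⟩
  · exact one_div_pos.2 (sub_pos.2 (one_lt_qnorm ((mem_primeSets.1 hD).1 P hP).2))
  · exact mem_primeSets.2 (by simp)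

/-- The sum `W` of all the Ramanujan sums equals the Selberg sum `L` at each sifted element, while
orthogonality gives `∑ W² = q ^ H * L` over the whole ball. Hence `|S| L² ≤ q ^ H L`. -/
theorem card_mul_selbergSum_le [Fintype K] {A : K[X]} {m H : ℕ} (hm : 2 * m ≤ H)
    {S : Finset K[X]} (hS : S ⊆ ball A H)
    (hr : ∀ F ∈ S, ∀ P : K[X], P.Monic → Irreducible P → P.natDegree ≤ m → ¬ P ∣ F) :
    (S.card : ℝ) * selbergSum K m ≤ (Fintype.card K : ℝ) ^ H := by
  classical
  let W : K[X] → ℝ := fun n => ∑ D ∈ primeSets K m, ramanujan D n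
  have hW : ∀ F ∈ S, W F = selbergSum K m := by
    intro F hF
    refine Finset.sum_congr rfl fun D hD => Finset.prod_congr rfl fun P hP => ?_
    have hP' := (mem_primeSets.1 hD).1 P hP
    have : P.natDegree ≤ m := (Finset.single_le_sum (f := fun P : K[X] => P.natDegree)
      (fun _ _ => Nat.zero_le _) hP).trans (mem_primeSets.1 hD).2
    simp [hr F hF P hP'.1 hP'.2 this]
  have h1 : (S.card : ℝ) * selbergSum K m ^ 2 ≤ ∑ n ∈ ball A H, W n ^ 2 := by
    calc (S.card : ℝ) * selbergSum K m ^ 2 = ∑ n ∈ S, W n ^ 2 := by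
          rw [Finset.sum_congr rfl fun F hF => by rw [hW F hF]]; simp
      _ ≤ _ := Finset.sum_le_sum_of_subset_of_nonneg hS fun _ _ _ => sq_nonneg _
  have h2 : ∑ n ∈ ball A H, W n ^ 2 = (Fintype.card K : ℝ) ^ H * selbergSum K m := by
    simp_rw [W, sq, Finset.sum_mul_sum]
    rw [Finset.sum_comm]
    simp_rw [Finset.sum_comm (s := ball A H)]
    rw [selbergSum, Finset.mul_sum]
    refine Finset.sum_congr rfl fun D hD => ?_
    rw [Finset.sum_congr rfl fun E hE => sum_ball_ramanujan_mul A hm hD hE]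
    simp [hD]
  have h3 := selbergSum_pos K m
  rw [h2] at h1
  nlinarith

/-- Bounds a sum over polynomials by a sum over their factorisations: one chosen factorisation per
polynomial gives an injection. -/
theorem Finset.sum_le_sum_of_cover {α β : Type*} {s : Finset α} {t : Finset β} (φ : β → α)
    {f : α → ℝ} {G : β → ℝ} (hcover : ∀ x ∈ s, ∃ y ∈ t, φ y = x ∧ f x ≤ G y)
    (hG : ∀ y ∈ t, 0 ≤ G y) : ∑ x ∈ s, f x ≤ ∑ y ∈ t, G y := by
  classical
  rcases isEmpty_or_nonempty β with hβ | hβ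
  · rw [Finset.sum_eq_zero fun x hx => hβ.elim (hcover x hx).choose]
    exact Finset.sum_nonneg hG
  choose! ψ hψ hφψ hfG using hcover
  have hinj : Set.InjOn ψ s := fun x hx x' hx' h => by
    rw [← hφψ x hx, ← hφψ x' hx', h]
  calc ∑ x ∈ s, f x ≤ ∑ x ∈ s, G (ψ x) := Finset.sum_le_sum hfG
    _ = ∑ y ∈ s.image ψ, G y := (Finset.sum_image hinj).symm
    _ ≤ _ := Finset.sum_le_sum_of_subset_of_nonneg
        (fun y hy => by obtain ⟨x, hx, rfl⟩ := Finset.mem_image.1 hy; exact hψ x hx)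
        fun y hy _ => hG y hy

/-! ### Monic polynomials and their factorisations -/

theorem mem_ball_X_pow_iff [Fintype K] {d : ℕ} {F : K[X]} :
    F ∈ ball (X ^ d) d ↔ F.Monic ∧ F.natDegree = d := by
  rw [mem_ball_iff]
  constructor
  · intro h
    have hF : F = X ^ d + (F - X ^ d) := by ring
    have hm : F.Monic := by rw [hF]; exact monic_X_pow_add h
    refine ⟨hm, ?_⟩
    rw [hF]
    apply natDegree_eq_of_degree_eq_some
    rw [degree_add_eq_left_of_degree_lt (by simpa using h), degree_X_pow]
  · rintro ⟨hm, hd⟩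
    have hdeg : F.degree = (X ^ d : K[X]).degree := by
      rw [degree_X_pow, degree_eq_natDegree hm.ne_zero, hd]
    have := degree_sub_lt_left hdeg hm.ne_zero (by rw [hm.leadingCoeff, leadingCoeff_X_pow])
    rwa [degree_eq_natDegree hm.ne_zero, hd] at this

open Classical in
/-- The monic polynomials of degree at most `m`. -/
noncomputable def monicsLE (K : Type*) [Field K] [Fintype K] (m : ℕ) : Finset K[X] :=
  (Finset.range (m + 1)).biUnion fun d => ball (X ^ d) d

theorem mem_monicsLE [Fintype K] {m : ℕ} {F : K[X]} :
    F ∈ monicsLE K m ↔ F.Monic ∧ F.natDegree ≤ m := by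
  simp only [monicsLE, Finset.mem_biUnion, Finset.mem_range, mem_ball_X_pow_iff]
  constructor
  · rintro ⟨d, hd, hF, rfl⟩
    exact ⟨hF, by omega⟩
  · rintro ⟨hF, hd⟩
    exact ⟨_, by omega, hF, rfl⟩

theorem sum_monicsLE [Fintype K] (m : ℕ) (f : ℕ → ℝ) :
    ∑ F ∈ monicsLE K m, f F.natDegree =
      ∑ d ∈ Finset.range (m + 1), (Fintype.card K : ℝ) ^ d * f d := by
  classical
  rw [monicsLE, Finset.sum_biUnion]
  · refine Finset.sum_congr rfl fun d _ => ?_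
    rw [Finset.sum_congr rfl fun F hF => by rw [(mem_ball_X_pow_iff.1 hF).2]]
    rw [Finset.sum_const, card_ball]
    simp
  · intro d _ e _ hde
    refine Finset.disjoint_left.2 fun F hd he => hde ?_
    rw [← (mem_ball_X_pow_iff.1 hd).2, (mem_ball_X_pow_iff.1 he).2]

theorem sum_geometric_le {x : ℝ} (hx0 : 0 ≤ x) (hx : x < 1) (n : ℕ) :
    ∑ i ∈ Finset.range n, x ^ i ≤ (1 - x)⁻¹ :=
  (tsum_geometric_of_lt_one hx0 hx) ▸
    (summable_geometric_of_lt_one hx0 hx).sum_le_tsum _ fun _ _ => pow_nonneg hx0 _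

/-- Induction on monic polynomials by multiplication by primes. -/
theorem Polynomial.Monic.prime_induction {motive : K[X] → Prop} (one : motive 1)
    (mul : ∀ P F : K[X], P.Monic → Irreducible P → F.Monic → motive F → motive (P * F))
    {F : K[X]} (hF : F.Monic) : motive F := by
  induction hn : F.natDegree using Nat.strong_induction_on generalizing F with
  | _ n ih =>
    by_cases h1 : F = 1
    · rwa [h1]
    · have hu : ¬ IsUnit F := fun hu => h1 (hF.eq_one_of_isUnit hu)
      obtain ⟨P, hPm, hP, G, rfl⟩ := exists_monic_irreducible_factor F hu
      have hG : G.Monic := hPm.of_mul_monic_left hF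
      refine mul P G hPm hP hG (ih _ ?_ hG rfl)
      rw [← hn, hPm.natDegree_mul hG]
      have := hP.natDegree_pos
      omega

theorem exists_pow_mul {P F : K[X]} (hP : P.Monic) (hP' : Irreducible P) (hF : F.Monic) :
    ∃ (e : ℕ) (G : K[X]), F = P ^ e * G ∧ G.Monic ∧ ¬ P ∣ G ∧ IsCoprime (P ^ e) G := by
  have hfin : FiniteMultiplicity P F :=
    FiniteMultiplicity.of_not_isUnit hP'.not_isUnit hF.ne_zero
  obtain ⟨G, hFG, hG⟩ := hfin.exists_eq_pow_mul_and_not_dvd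
  refine ⟨_, G, hFG, ?_, hG, (hP'.coprime_iff_not_dvd.2 hG).pow_left⟩
  rw [hFG] at hF
  exact (hP.pow _).of_mul_monic_left hF

/-- Induction on monic polynomials by multiplication by coprime prime powers. -/
theorem Polynomial.Monic.prime_pow_induction {motive : K[X] → Prop} (one : motive 1)
    (mul : ∀ (P F : K[X]) (e : ℕ), P.Monic → Irreducible P → F.Monic → 1 ≤ e →
      IsCoprime (P ^ e) F → motive F → motive (P ^ e * F))
    {F : K[X]} (hF : F.Monic) : motive F := by
  induction hn : F.natDegree using Nat.strong_induction_on generalizing F with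
  | _ n ih =>
    by_cases h1 : F = 1
    · rwa [h1]
    · have hu : ¬ IsUnit F := fun hu => h1 (hF.eq_one_of_isUnit hu)
      obtain ⟨P, hPm, hP, hd⟩ := exists_monic_irreducible_factor F hu
      obtain ⟨e, G, rfl, hG, hPG, hco⟩ := exists_pow_mul hPm hP hF
      have he : 1 ≤ e := by
        rcases Nat.eq_zero_or_pos e with rfl | h
        · rw [pow_zero, one_mul] at hd; exact absurd hd hPG
        · exact h
      refine mul P G e hPm hP hG he hco (ih _ ?_ hG rfl)
      rw [← hn, (hPm.pow e).natDegree_mul hG, hPm.natDegree_pow]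
      have := Nat.mul_pos he hP.natDegree_pos
      omega

open Classical in
theorem exists_sq_mul_prod_primes {F : K[X]} (hF : F.Monic) :
    ∃ (a : K[X]) (D : Finset K[X]), a.Monic ∧ (∀ P ∈ D, P.Monic ∧ Irreducible P) ∧
      F = a ^ 2 * ∏ P ∈ D, P := by
  refine hF.prime_induction (motive := fun F => ∃ (a : K[X]) (D : Finset K[X]), a.Monic ∧
    (∀ P ∈ D, P.Monic ∧ Irreducible P) ∧ F = a ^ 2 * ∏ P ∈ D, P) ?_ ?_
  · exact ⟨1, ∅, monic_one, by simp, by simp⟩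
  · intro P F hP hP' hF ih
    obtain ⟨a, D, ha, hD, rfl⟩ := ih
    by_cases h : P ∈ D
    · refine ⟨P * a, D.erase P, hP.mul ha, fun Q hQ => hD Q (Finset.mem_of_mem_erase hQ), ?_⟩
      rw [← Finset.mul_prod_erase D (fun P => P) h]
      ring
    · refine ⟨a, insert P D, ha, ?_, ?_⟩
      · intro Q hQ
        rcases Finset.mem_insert.1 hQ with rfl | hQ
        exacts [⟨hP, hP'⟩, hD Q hQ]
      · rw [Finset.prod_insert h]
        ring

/-! ### Size of the Selberg sum and a Chebyshev bound -/

/-- The sum of `1 / |F|` over monic `F` of degree at most `m` is exactly `m + 1`. Writing `F` as a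
square times a product of distinct primes bounds it by `∑ 1 / |a|² ≤ 2` times the Selberg sum, since
`1 / |P| ≤ 1 / (|P| - 1)`. -/
theorem le_selbergSum (K : Type*) [Field K] [Fintype K] (m : ℕ) :
    (m + 1 : ℝ) ≤ 2 * selbergSum K m := by
  have hq := two_le_card_real K
  have hq0 := card_real_pos K
  have h1 : ∑ F ∈ monicsLE K m, (qnorm F)⁻¹ = m + 1 := by
    refine (sum_monicsLE m fun d => ((Fintype.card K : ℝ) ^ d)⁻¹).trans ?_
    rw [Finset.sum_congr rfl fun d _ => mul_inv_cancel₀ (pow_pos hq0 d).ne']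
    simp
  have h2 : ∑ a ∈ monicsLE K m, (qnorm a ^ 2)⁻¹ ≤ 2 := by
    refine (sum_monicsLE m fun d => (((Fintype.card K : ℝ) ^ d) ^ 2)⁻¹).le.trans ?_
    calc _ ≤ ∑ d ∈ Finset.range (m + 1), (1 / 2 : ℝ) ^ d := by
          refine Finset.sum_le_sum fun d _ => ?_
          have : (2 : ℝ) ^ d ≤ (Fintype.card K : ℝ) ^ d := pow_le_pow_left₀ zero_le_two hq d
          have h0 := pow_pos hq0 d
          rw [sq, mul_inv, mul_inv_cancel_left₀ h0.ne', one_div, inv_pow]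
          exact inv_anti₀ (by positivity) this
      _ ≤ (1 - 1 / 2 : ℝ)⁻¹ := sum_geometric_le (by norm_num) (by norm_num) _
      _ = 2 := by norm_num
  have h3 : ∑ F ∈ monicsLE K m, (qnorm F)⁻¹ ≤
      ∑ y ∈ monicsLE K m ×ˢ primeSets K m,
        (qnorm y.1 ^ 2)⁻¹ * ∏ P ∈ y.2, 1 / (qnorm P - 1) := by
    refine Finset.sum_le_sum_of_cover (fun y => y.1 ^ 2 * ∏ P ∈ y.2, P) ?_ ?_
    · intro F hF
      obtain ⟨hF, hFd⟩ := mem_monicsLE.1 hF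
      obtain ⟨a, D, ha, hD, rfl⟩ := exists_sq_mul_prod_primes hF
      have hDm := monic_prod_of_monic D (fun P => P) fun P hP => (hD P hP).1
      rw [(ha.pow 2).natDegree_mul hDm, ha.natDegree_pow,
        natDegree_prod_of_monic _ _ fun P hP => (hD P hP).1] at hFd
      refine ⟨(a, D), Finset.mem_product.2 ⟨mem_monicsLE.2 ⟨ha, by dsimp only; omega⟩,
        mem_primeSets.2 ⟨hD, by dsimp only; omega⟩⟩, rfl, ?_⟩
      rw [qnorm_mul (ha.pow 2) hDm, qnorm_pow ha, mul_inv,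
        qnorm_prod fun P hP => (hD P hP).1, ← Finset.prod_inv_distrib]
      refine mul_le_mul_of_nonneg_left (Finset.prod_le_prod (fun P _ => ?_) fun P hP => ?_) ?_
      · exact (inv_pos.2 (qnorm_pos P)).le
      · rw [one_div]
        exact inv_anti₀ (sub_pos.2 (one_lt_qnorm (hD P hP).2)) (by linarith)
      · positivity
    · rintro ⟨a, D⟩ hy
      refine mul_nonneg (by positivity) (Finset.prod_nonneg fun P hP => ?_)
      have := (mem_primeSets.1 (Finset.mem_product.1 hy).2).1 P hP
      exact (one_div_pos.2 (sub_pos.2 (one_lt_qnorm this.2))).le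
  rw [h1, Finset.sum_product] at h3
  dsimp only at h3
  rw [← Finset.sum_mul_sum] at h3
  exact h3.trans (mul_le_mul_of_nonneg_right h2 (selbergSum_pos K m).le)

/-- The sieve bound for the number of elements of a ball without prime factors of degree at
most `m`. -/
theorem card_rough_le [Fintype K] {A : K[X]} {m H : ℕ} (hm : 2 * m ≤ H)
    {S : Finset K[X]} (hS : S ⊆ ball A H)
    (hr : ∀ F ∈ S, ∀ P : K[X], P.Monic → Irreducible P → P.natDegree ≤ m → ¬ P ∣ F) :
    (S.card : ℝ) ≤ 2 * (Fintype.card K : ℝ) ^ H / (m + 1) := by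
  rw [le_div_iff₀ (by positivity)]
  have h1 := card_mul_selbergSum_le hm hS hr
  have h2 := le_selbergSum K m
  have : (S.card : ℝ) * (m + 1) ≤ S.card * (2 * selbergSum K m) :=
    mul_le_mul_of_nonneg_left h2 (Nat.cast_nonneg _)
  linarith

/-- The distinct prime factors of a monic polynomial of degree `k` have total degree at most `k`;
averaging over all such polynomials gives the bound. -/
theorem sum_natDegree_div_qnorm_le (K : Type*) [Field K] [Fintype K] (k : ℕ) :
    ∑ P ∈ primes K k, (P.natDegree : ℝ) / qnorm P ≤ k := by
  classical
  have hq0 := pow_pos (card_real_pos K) k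
  have h1 : ∑ n ∈ ball (X ^ k : K[X]) k, ∑ P ∈ primes K k,
      (P.natDegree : ℝ) * (if P ∣ n then 1 else 0) ≤ ∑ n ∈ ball (X ^ k : K[X]) k, (k : ℝ) := by
    refine Finset.sum_le_sum fun n hn => ?_
    obtain ⟨hn, hnd⟩ := mem_ball_X_pow_iff.1 hn
    simp only [mul_ite, mul_one, mul_zero]
    rw [← Finset.sum_filter, ← Nat.cast_sum, Nat.cast_le]
    have hD : ∀ P ∈ (primes K k).filter (· ∣ n), P.Monic ∧ Irreducible P := fun P hP =>
      have := mem_primes.1 (Finset.mem_filter.1 hP).1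
      ⟨this.1, this.2.1⟩
    rw [← natDegree_prod_of_monic _ (fun P => P) fun P hP => (hD P hP).1]
    refine le_trans (natDegree_le_of_dvd
      ((prod_dvd_iff_of_primes hD n).2 fun P hP => (Finset.mem_filter.1 hP).2) hn.ne_zero) hnd.le
  rw [Finset.sum_comm] at h1
  have h2 : ∑ P ∈ primes K k, ∑ n ∈ ball (X ^ k : K[X]) k,
      (P.natDegree : ℝ) * (if P ∣ n then 1 else 0) =
      (Fintype.card K : ℝ) ^ k * ∑ P ∈ primes K k, (P.natDegree : ℝ) / qnorm P := by
    rw [Finset.mul_sum]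
    refine Finset.sum_congr rfl fun P hP => ?_
    have := mem_primes.1 hP
    rw [← Finset.mul_sum, Finset.sum_boole, card_filter_dvd_ball_real this.1 this.2.2]
    ring
  rw [h2, Finset.sum_const, card_ball, nsmul_eq_mul, Nat.cast_pow] at h1
  exact le_of_mul_le_mul_left h1 hq0

/-! ### Smooth polynomials, Euler products and Rankin's trick -/

open Classical in
/-- The monic polynomials of degree at most `Z` all of whose prime factors lie in `U`. -/
noncomputable def smoothOver [Fintype K] (U : Finset K[X]) (Z : ℕ) : Finset K[X] :=
  (monicsLE K Z).filter fun F => ∀ P : K[X], P.Monic → Irreducible P → P ∣ F → P ∈ U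

theorem mem_smoothOver [Fintype K] {U : Finset K[X]} {Z : ℕ} {F : K[X]} :
    F ∈ smoothOver U Z ↔ F.Monic ∧ F.natDegree ≤ Z ∧
      ∀ P : K[X], P.Monic → Irreducible P → P ∣ F → P ∈ U := by
  simp [smoothOver, mem_monicsLE, and_assoc]

theorem sum_smoothOver_le_prod [Fintype K] {f : K[X] → ℝ} (hf : ∀ F : K[X], F.Monic → 0 ≤ f F)
    (hf1 : f 1 = 1) (hmul : ∀ F G : K[X], F.Monic → G.Monic → IsCoprime F G →
      f (F * G) = f F * f G) {U : Finset K[X]} (hU : ∀ P ∈ U, P.Monic ∧ Irreducible P) (Z : ℕ) :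
    ∑ b ∈ smoothOver U Z, f b ≤ ∏ P ∈ U, ∑ l ∈ Finset.range (Z + 1), f (P ^ l) := by
  classical
  induction U using Finset.induction_on with
  | empty =>
    have : smoothOver (∅ : Finset K[X]) Z ⊆ {1} := by
      intro F hF
      obtain ⟨hF, -, h⟩ := mem_smoothOver.1 hF
      by_contra h1
      have hu : ¬ IsUnit F := fun hu => h1 (by simpa using hF.eq_one_of_isUnit hu)
      obtain ⟨P, hPm, hP, hd⟩ := exists_monic_irreducible_factor F hu
      simpa using h P hPm hP hd
    refine (Finset.sum_le_sum_of_subset_of_nonneg this ?_).trans ?_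
    · intro F hF _
      rw [Finset.mem_singleton.1 hF, hf1]
      exact zero_le_one
    · simp [hf1]
  | insert P U hPU ih =>
    obtain ⟨hP, hP'⟩ := hU P (Finset.mem_insert_self _ _)
    have hU' : ∀ Q ∈ U, Q.Monic ∧ Irreducible Q := fun Q hQ => hU Q (Finset.mem_insert_of_mem hQ)
    rw [Finset.prod_insert hPU]
    have h1 : ∑ b ∈ smoothOver (insert P U) Z, f b ≤
        ∑ y ∈ Finset.range (Z + 1) ×ˢ smoothOver U Z, f (P ^ y.1) * f y.2 := by
      refine Finset.sum_le_sum_of_cover (fun y => P ^ y.1 * y.2) ?_ ?_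
      · intro F hF
        obtain ⟨hF, hFd, hFU⟩ := mem_smoothOver.1 hF
        obtain ⟨e, G, rfl, hG, hPG, hco⟩ := exists_pow_mul hP hP' hF
        rw [(hP.pow e).natDegree_mul hG, hP.natDegree_pow] at hFd
        have he : e ≤ e * P.natDegree := Nat.le_mul_of_pos_right _ hP'.natDegree_pos
        refine ⟨(e, G), Finset.mem_product.2 ⟨Finset.mem_range.2 (by dsimp only; omega),
          mem_smoothOver.2 ⟨hG, by dsimp only; omega, ?_⟩⟩, rfl,
          (hmul _ _ (hP.pow e) hG hco).le⟩
        intro Q hQ hQ' hQG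
        refine (Finset.mem_insert.1 (hFU Q hQ hQ' (hQG.mul_left _))).resolve_left ?_
        rintro rfl
        exact hPG hQG
      · rintro ⟨e, G⟩ hy
        have hG := mem_smoothOver.1 (Finset.mem_product.1 hy).2
        exact mul_nonneg (hf _ (hP.pow _)) (hf _ hG.1)
    rw [Finset.sum_product] at h1
    dsimp only at h1
    rw [← Finset.sum_mul_sum] at h1
    exact h1.trans (mul_le_mul_of_nonneg_left (ih hU')
      (Finset.sum_nonneg fun l _ => hf _ (hP.pow _)))

namespace IsShiuFunction

variable {δ A₁ A₂ : ℝ} {g : K[X] → ℝ}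

theorem one_le (hg : IsShiuFunction δ A₁ A₂ g) : 1 ≤ A₂ := by
  simpa [hg.map_one] using hg.le_two_rpow 1 monic_one

/-- The base `16/15` is chosen so that a twist by `w ≤ 5/4` gives growth `4/3` per degree, and
`(4/3)² < 2 ≤ q` makes the higher prime powers summable. -/
theorem le_pow (hg : IsShiuFunction δ A₁ A₂ g) (hδ : δ ≤ 1 / 48) {F : K[X]} (hF : F.Monic) :
    g F ≤ A₂ * (16 / 15 : ℝ) ^ F.natDegree := by
  refine (hg.le_two_rpow F hF).trans
    (mul_le_mul_of_nonneg_left ?_ (zero_le_one.trans hg.one_le))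
  rw [Real.rpow_mul zero_le_two, Real.rpow_natCast]
  refine pow_le_pow_left₀ (by positivity) ?_ _
  calc (2 : ℝ) ^ δ ≤ 2 ^ (1 / 48 : ℝ) := Real.rpow_le_rpow_of_exponent_le one_le_two hδ
    _ ≤ ((16 / 15 : ℝ) ^ (48 : ℕ)) ^ (1 / 48 : ℝ) :=
      Real.rpow_le_rpow zero_le_two (by norm_num) (by norm_num)
    _ = 16 / 15 := by
      rw [← Real.rpow_natCast, ← Real.rpow_mul (by norm_num)]
      norm_num

theorem one : IsShiuFunction (K := K) 0 1 1 fun _ => 1 where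
  nonneg _ _ := zero_le_one
  map_one := rfl
  map_mul _ _ _ _ _ := (one_mul 1).symm
  prime_pow_le _ _ _ _ _ := by simp
  le_two_rpow _ _ := by simp

/-- The twist of `g` by `w ^ deg / q ^ deg`. -/
noncomputable def twist [Fintype K] (g : K[X] → ℝ) (w : ℝ) (F : K[X]) : ℝ :=
  g F * w ^ F.natDegree / qnorm F

theorem twist_pow_le [Fintype K] (hg : IsShiuFunction δ A₁ A₂ g) (hδ : δ ≤ 1 / 48) {w : ℝ}
    (hw0 : 0 ≤ w) (hw : w ≤ 5 / 4) {P : K[X]} (hP : P.Monic) (l : ℕ) :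
    twist g w (P ^ l) ≤ A₂ * ((4 / 3 : ℝ) ^ P.natDegree / qnorm P) ^ l := by
  have hA := hg.one_le
  rw [twist, qnorm_pow hP, div_pow, ← mul_div_assoc]
  refine div_le_div_of_nonneg_right ?_ (pow_pos (qnorm_pos P) _).le
  calc _ ≤ A₂ * (16 / 15 : ℝ) ^ (P ^ l).natDegree * (5 / 4) ^ (P ^ l).natDegree :=
        mul_le_mul (hg.le_pow hδ (hP.pow l)) (pow_le_pow_left₀ hw0 hw _) (pow_nonneg hw0 _)
          (by positivity)
    _ = _ := by
      rw [mul_assoc, ← mul_pow, hP.natDegree_pow, ← pow_mul, mul_comm l]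
      norm_num

/-- The terms with `l ≥ 2` are dominated by a geometric series of ratio at most `2/3`, hence the
factor 3; then `1 + y ≤ exp y`. -/
theorem sum_twist_pow_le [Fintype K] (hg : IsShiuFunction δ A₁ A₂ g) (hδ : δ ≤ 1 / 48) {w : ℝ}
    (hw0 : 0 ≤ w) (hw : w ≤ 5 / 4) {P : K[X]} (hP : P.Monic) (hP' : Irreducible P) (Z : ℕ) :
    ∑ l ∈ Finset.range (Z + 1), twist g w (P ^ l) ≤
      Real.exp (twist g w P + 3 * A₂ * ((4 / 3 : ℝ) ^ P.natDegree / qnorm P) ^ 2) := by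
  have hA := hg.one_le
  set x := (4 / 3 : ℝ) ^ P.natDegree / qnorm P with hx
  have hx0 : 0 ≤ x := div_nonneg (by positivity) (qnorm_pos P).le
  have hx1 : x ≤ 2 / 3 := by
    calc x ≤ (4 / 3 : ℝ) ^ P.natDegree / 2 ^ P.natDegree :=
          div_le_div_of_nonneg_left (by positivity) (by positivity) (two_pow_le_qnorm P)
      _ = (2 / 3 : ℝ) ^ P.natDegree := by rw [← div_pow]; norm_num
      _ ≤ 2 / 3 := pow_le_of_le_one (by norm_num) (by norm_num) hP'.natDegree_pos.ne'
  have hnn : ∀ l, 0 ≤ twist g w (P ^ l) := fun l =>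
    div_nonneg (mul_nonneg (hg.nonneg _ (hP.pow l)) (pow_nonneg hw0 _)) (qnorm_pos _).le
  calc _ ≤ ∑ l ∈ Finset.range (Z + 1 + 1), twist g w (P ^ l) :=
        Finset.sum_le_sum_of_subset_of_nonneg (Finset.range_mono (Nat.le_succ _))
          fun _ _ _ => hnn _
    _ = ∑ l ∈ Finset.range Z, twist g w (P ^ (l + 2)) + twist g w P + 1 := by
      rw [Finset.sum_range_succ', Finset.sum_range_succ']
      simp [twist, hg.map_one, qnorm]
    _ ≤ ∑ l ∈ Finset.range Z, A₂ * x ^ 2 * x ^ l + twist g w P + 1 := by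
      gcongr with l
      refine (hg.twist_pow_le hδ hw0 hw hP _).trans_eq ?_
      rw [pow_add]
      ring
    _ ≤ A₂ * x ^ 2 * 3 + twist g w P + 1 := by
      rw [← Finset.mul_sum]
      gcongr
      refine (sum_geometric_le hx0 (by linarith) _).trans ?_
      rw [inv_le_comm₀ (by linarith) (by norm_num)]
      linarith
    _ ≤ _ := by
      refine le_trans (le_of_eq ?_) (Real.add_one_le_exp _)
      ring

theorem sum_sq_le (K : Type*) [Field K] [Fintype K] (k : ℕ) :
    ∑ P ∈ primes K k, ((4 / 3 : ℝ) ^ P.natDegree / qnorm P) ^ 2 ≤ 9 := by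
  have hq := two_le_card_real K
  have hq0 := card_real_pos K
  calc _ ≤ ∑ F ∈ monicsLE K k, ((4 / 3 : ℝ) ^ F.natDegree / qnorm F) ^ 2 :=
        Finset.sum_le_sum_of_subset_of_nonneg
          (fun P hP => mem_monicsLE.2 ⟨(mem_primes.1 hP).1, (mem_primes.1 hP).2.2⟩)
          fun _ _ _ => sq_nonneg _
    _ = _ := sum_monicsLE k fun d => ((4 / 3 : ℝ) ^ d / (Fintype.card K : ℝ) ^ d) ^ 2
    _ ≤ ∑ d ∈ Finset.range (k + 1), (8 / 9 : ℝ) ^ d := by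
      refine Finset.sum_le_sum fun d _ => ?_
      have h1 : (2 : ℝ) ^ d ≤ (Fintype.card K : ℝ) ^ d := pow_le_pow_left₀ zero_le_two hq d
      have h0 := pow_pos hq0 d
      calc _ = ((4 / 3 : ℝ) ^ d) ^ 2 / (Fintype.card K : ℝ) ^ d := by field_simp
        _ ≤ ((4 / 3 : ℝ) ^ d) ^ 2 / 2 ^ d :=
          div_le_div_of_nonneg_left (by positivity) (by positivity) h1
        _ = (8 / 9 : ℝ) ^ d := by
          rw [← pow_mul, mul_comm, pow_mul, ← div_pow]
          norm_num
    _ ≤ (1 - 8 / 9 : ℝ)⁻¹ := sum_geometric_le (by norm_num) (by norm_num) _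
    _ = 9 := by norm_num

open Classical in
/-- Rankin's bound for sums over smooth polynomials. -/
theorem sum_smooth_le [Fintype K] (hg : IsShiuFunction δ A₁ A₂ g) (hδ : δ ≤ 1 / 48) {w : ℝ}
    (hw1 : 1 ≤ w) (hw : w ≤ 5 / 4) (k Y Z : ℕ) :
    ∑ b ∈ (smoothOver (primes K k) Z).filter (Y ≤ ·.natDegree), g b / qnorm b ≤
      Real.exp (27 * A₂) * (w ^ Y)⁻¹ *
        Real.exp (∑ P ∈ primes K k, g P * w ^ P.natDegree / qnorm P) := by
  have hw0 : 0 < w := zero_lt_one.trans_le hw1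
  have hA := hg.one_le
  have hnn : ∀ F : K[X], F.Monic → 0 ≤ twist g w F := fun F hF =>
    div_nonneg (mul_nonneg (hg.nonneg _ hF) (pow_nonneg hw0.le _)) (qnorm_pos _).le
  have hU : ∀ P ∈ primes K k, P.Monic ∧ Irreducible P := fun P hP =>
    ⟨(mem_primes.1 hP).1, (mem_primes.1 hP).2.1⟩
  -- Rankin's trick: `1 ≤ w ^ (deg b - Y)` on the range of summation.
  have h1 : ∑ b ∈ (smoothOver (primes K k) Z).filter (Y ≤ ·.natDegree), g b / qnorm b ≤
      (w ^ Y)⁻¹ * ∑ b ∈ smoothOver (primes K k) Z, twist g w b := by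
    rw [Finset.mul_sum]
    refine le_trans (Finset.sum_le_sum (g := fun b => (w ^ Y)⁻¹ * twist g w b) fun b hb => ?_)
      (Finset.sum_le_sum_of_subset_of_nonneg (Finset.filter_subset _ _) fun b hb _ =>
        mul_nonneg (by positivity) (hnn b (mem_smoothOver.1 hb).1))
    obtain ⟨hb, hY⟩ := Finset.mem_filter.1 hb
    have hgb := hg.nonneg b (mem_smoothOver.1 hb).1
    have hq := qnorm_pos b
    have hwY : w ^ Y ≤ w ^ b.natDegree := pow_le_pow_right₀ hw1 hY
    rw [twist, inv_mul_eq_div, le_div_iff₀ (by positivity), div_mul_eq_mul_div]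
    gcongr
  have h2 : ∑ b ∈ smoothOver (primes K k) Z, twist g w b ≤
      Real.exp (27 * A₂) * Real.exp (∑ P ∈ primes K k, g P * w ^ P.natDegree / qnorm P) := by
    refine (sum_smoothOver_le_prod hnn ?_ ?_ hU Z).trans ?_
    · simp [twist, hg.map_one, qnorm]
    · intro F G hF hG hFG
      rw [twist, hg.map_mul F G hF hG hFG, qnorm_mul hF hG, hF.natDegree_mul hG, pow_add,
        twist, twist]
      ring
    · refine (Finset.prod_le_prod (fun P hP => Finset.sum_nonneg fun l _ =>
        hnn _ ((hU P hP).1.pow l)) fun P hP =>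
          hg.sum_twist_pow_le hδ hw0.le hw (hU P hP).1 (hU P hP).2 Z).trans ?_
      rw [← Real.exp_sum, ← Real.exp_add, Real.exp_le_exp, Finset.sum_add_distrib, add_comm,
        ← Finset.mul_sum]
      refine add_le_add ?_ le_rfl
      have := sum_sq_le K k
      nlinarith
  calc _ ≤ _ := h1
    _ ≤ _ := mul_le_mul_of_nonneg_left h2 (by positivity)
    _ = _ := by ring

/-- Counted with multiplicity, `c` has at most `deg c / k` prime factors, and each contributes at
most a factor `A`. -/
theorem le_rpow_of_rough (hg : IsShiuFunction δ A₁ A₂ g) {A : ℝ} (hA : 1 ≤ A) (hA₁ : 0 ≤ A₁)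
    (hAA : A₁ ≤ A) {k : ℕ} (hk : 0 < k) {c : K[X]} (hc : c.Monic)
    (hr : ∀ Q : K[X], Q.Monic → Irreducible Q → Q ∣ c → k ≤ Q.natDegree) :
    g c ≤ A ^ ((c.natDegree : ℝ) / k) := by
  have hk' : (0 : ℝ) < k := Nat.cast_pos.2 hk
  revert hr
  refine hc.prime_pow_induction (motive := fun c =>
    (∀ Q : K[X], Q.Monic → Irreducible Q → Q ∣ c → k ≤ Q.natDegree) →
      g c ≤ A ^ ((c.natDegree : ℝ) / k)) ?_ ?_
  · simp [hg.map_one]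
  · intro P F e hP hP' hF he hco ih hr
    have h1 : k ≤ P.natDegree :=
      hr P hP hP' ((dvd_pow_self P (by omega)).mul_right _)
    have h2 := ih fun Q hQ hQ' hQF => hr Q hQ hQ' (hQF.mul_left _)
    have h3 : g (P ^ e) ≤ A ^ (e : ℝ) := by
      rw [Real.rpow_natCast]
      exact (hg.prime_pow_le P hP hP' e he).trans (pow_le_pow_left₀ hA₁ hAA e)
    rw [hg.map_mul _ _ (hP.pow e) hF hco, (hP.pow e).natDegree_mul hF, hP.natDegree_pow]
    refine (mul_le_mul h3 h2 (hg.nonneg _ hF) (by positivity)).trans ?_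
    rw [← Real.rpow_add (by linarith)]
    refine Real.rpow_le_rpow_of_exponent_le hA ?_
    rw [le_div_iff₀ hk', add_mul, div_mul_cancel₀ _ hk'.ne']
    push_cast
    have : (k : ℝ) ≤ P.natDegree := by exact_mod_cast h1
    gcongr

end IsShiuFunction

/-! ### Cutting a polynomial at a prescribed degree -/

/-- `F = b * c` with `deg b ≤ Z`, where the primes of `c` have degree at least that of its prime
divisor `P`, those of `b` have degree at most that of `P`, and a power of `P` of degree exceeding
`Z - deg b` divides `F`. -/
structure IsCut (Z : ℕ) (F b c P : K[X]) : Prop where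
  eq : F = b * c
  monic_left : b.Monic
  monic_right : c.Monic
  coprime : IsCoprime b c
  monic : P.Monic
  irreducible : Irreducible P
  natDegree_le : b.natDegree ≤ Z
  smooth : ∀ Q : K[X], Q.Monic → Irreducible Q → Q ∣ b → Q.natDegree ≤ P.natDegree
  rough : ∀ Q : K[X], Q.Monic → Irreducible Q → Q ∣ c → P.natDegree ≤ Q.natDegree
  exists_pow : ∃ e : ℕ, P ^ e ∣ F ∧ Z < b.natDegree + e * P.natDegree

/-- Greedy: the full power of a prime of least degree in `c` is moved into `b` until this would
exceed `Z`. Ties between primes of equal degree are broken arbitrarily, so smoothness and roughness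
are both non-strict. -/
theorem exists_isCut {Z : ℕ} {F : K[X]} (hF : F.Monic) (hZ : Z < F.natDegree) :
    ∃ b c P, IsCut Z F b c P := by
  have main : ∀ (n : ℕ) (b c : K[X]), Z - b.natDegree = n → b.natDegree ≤ Z → b.Monic →
      c.Monic → F = b * c → IsCoprime b c →
      (∀ Q R : K[X], Q.Monic → Irreducible Q → Q ∣ b → R.Monic → Irreducible R → R ∣ c →
        Q.natDegree ≤ R.natDegree) → ∃ b c P, IsCut Z F b c P := by
    intro n
    induction n using Nat.strong_induction_on with
    | _ n ih =>
      intro b c hn hbZ hb hc hFbc hco hbc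
      classical
      have hu : ¬ IsUnit c := by
        intro hu
        rw [hFbc, hc.eq_one_of_isUnit hu, mul_one] at hZ
        omega
      have hex : ∃ d : ℕ, ∃ P : K[X], P.Monic ∧ Irreducible P ∧ P ∣ c ∧ P.natDegree = d := by
        obtain ⟨P, hP, hP', hd⟩ := exists_monic_irreducible_factor c hu
        exact ⟨_, P, hP, hP', hd, rfl⟩
      obtain ⟨P, hP, hP', hPc, hPd⟩ := Nat.find_spec hex
      have hmin : ∀ Q : K[X], Q.Monic → Irreducible Q → Q ∣ c → P.natDegree ≤ Q.natDegree :=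
        fun Q hQ hQ' hQc => hPd ▸ Nat.find_min' hex ⟨Q, hQ, hQ', hQc, rfl⟩
      obtain ⟨e, c', rfl, hc', hPc', hco'⟩ := exists_pow_mul hP hP' hc
      have he : e ≠ 0 := by
        rintro rfl
        rw [pow_zero, one_mul] at hPc
        exact hPc' hPc
      by_cases hcase : Z < b.natDegree + e * P.natDegree
      · refine ⟨b, P ^ e * c', P, hFbc, hb, hc, hco, hP, hP', hbZ, ?_, hmin, e, ?_, hcase⟩
        · exact fun Q hQ hQ' hQb => hbc Q P hQ hQ' hQb hP hP' hPc
        · exact hFbc ▸ (Dvd.intro _ rfl).mul_left _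
      · have hdeg : (b * P ^ e).natDegree = b.natDegree + e * P.natDegree := by
          rw [hb.natDegree_mul (hP.pow e), hP.natDegree_pow]
        have hpos := Nat.mul_pos (Nat.pos_of_ne_zero he) hP'.natDegree_pos
        refine ih (Z - (b * P ^ e).natDegree) (by omega) (b * P ^ e) c' rfl (by omega)
          (hb.mul (hP.pow e)) hc' (by rw [hFbc, mul_assoc]) ?_ ?_
        · exact IsCoprime.mul_left hco.of_mul_right_right hco'
        · intro Q R hQ hQ' hQb hR hR' hRc
          rcases hQ'.prime.dvd_or_dvd hQb with h | h
          · exact hbc Q R hQ hQ' h hR hR' (hRc.mul_left _)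
          · have := eq_of_monic_of_associated hQ hP
              (hQ'.associated_of_dvd hP' (hQ'.prime.dvd_of_dvd_pow h))
            exact this ▸ hmin R hR hR' (hRc.mul_left _)
  refine main _ 1 F rfl (by simp) monic_one hF (one_mul F).symm isCoprime_one_left ?_
  intro Q R hQ hQ' hQ1
  exact absurd (isUnit_of_dvd_one hQ1) hQ'.not_isUnit

/-! ### Counting the two exceptional classes -/

theorem card_le_sum_of_dvd [Fintype K] {ι : Type*} {A : K[X]} {H : ℕ} {S : Finset K[X]}
    (hS : S ⊆ ball A H) {D : Finset ι} {φ : ι → K[X]}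
    (hφ : ∀ i ∈ D, (φ i).Monic ∧ (φ i).natDegree ≤ H) (h : ∀ F ∈ S, ∃ i ∈ D, φ i ∣ F) :
    (S.card : ℝ) ≤ (Fintype.card K : ℝ) ^ H * ∑ i ∈ D, (qnorm (φ i))⁻¹ := by
  classical
  have h1 : S ⊆ D.biUnion fun i => (ball A H).filter (φ i ∣ ·) := by
    intro F hF
    obtain ⟨i, hi, hd⟩ := h F hF
    exact Finset.mem_biUnion.2 ⟨i, hi, Finset.mem_filter.2 ⟨hS hF, hd⟩⟩
  have h2 := (Finset.card_le_card h1).trans Finset.card_biUnion_le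
  calc (S.card : ℝ) ≤ ∑ i ∈ D, (((ball A H).filter (φ i ∣ ·)).card : ℝ) := by exact_mod_cast h2
    _ = _ := by
      rw [Finset.mul_sum]
      refine Finset.sum_congr rfl fun i hi => ?_
      rw [card_filter_dvd_ball_real (hφ i hi).1 (hφ i hi).2, div_eq_mul_inv]

theorem IsCut.natDegree_right_le {Z : ℕ} {F b c P : K[X]} (h : IsCut Z F b c P) :
    c.natDegree ≤ F.natDegree := by
  rw [h.eq, h.monic_left.natDegree_mul h.monic_right]
  exact Nat.le_add_left _ _

/-- Since `deg b ≤ z`, the power of `P` dividing `F` has degree exceeding `z`. Its least such power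
has degree at most `2 z`, so its multiples are counted exactly. That degree exceeds `z` and is at
least `2 deg P`, hence at least `deg P + z / 2`; the Chebyshev bound then sums over `P`. -/
theorem card_le_of_isCut_of_le [Fintype K] {A : K[X]} {H z : ℕ} (hH : 2 * z ≤ H)
    {S : Finset K[X]} (hS : S ⊆ ball A H)
    (hcut : ∀ F ∈ S, ∃ b c P, IsCut (2 * z) F b c P ∧ P.natDegree ≤ z ∧ b.natDegree ≤ z) :
    (S.card : ℝ) ≤ (Fintype.card K : ℝ) ^ H * (z / 2 ^ (z / 2)) := by
  have hdeg : ∀ P ∈ primes K z, z < (z / P.natDegree + 1) * P.natDegree ∧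
      (z / P.natDegree + 1) * P.natDegree ≤ z + P.natDegree ∧
      2 * P.natDegree ≤ (z / P.natDegree + 1) * P.natDegree := by
    intro P hP
    obtain ⟨-, hP', hPz⟩ := mem_primes.1 hP
    have h0 := hP'.natDegree_pos
    refine ⟨Nat.lt_mul_of_div_lt (Nat.lt_succ_self _) h0, ?_, ?_⟩
    · rw [add_mul, one_mul]
      exact Nat.add_le_add_right (Nat.div_mul_le_self _ _) _
    · have : 1 ≤ z / P.natDegree := (Nat.one_le_div_iff h0).2 hPz
      exact Nat.mul_le_mul_right _ (by omega)
  refine (card_le_sum_of_dvd hS (D := primes K z)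
    (φ := fun P => P ^ (z / P.natDegree + 1)) ?_ ?_).trans ?_
  · intro P hP
    have hP1 := mem_primes.1 hP
    refine ⟨hP1.1.pow _, ?_⟩
    rw [hP1.1.natDegree_pow]
    have := hdeg P hP
    omega
  · intro F hF
    obtain ⟨b, c, P, h, hPz, hbz⟩ := hcut F hF
    refine ⟨P, mem_primes.2 ⟨h.monic, h.irreducible, hPz⟩, ?_⟩
    obtain ⟨e, he, hZ⟩ := h.exists_pow
    refine (pow_dvd_pow P ?_).trans he
    rw [Nat.succ_le_iff, Nat.div_lt_iff_lt_mul h.irreducible.natDegree_pos]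
    omega
  · refine mul_le_mul_of_nonneg_left ?_ (pow_pos (card_real_pos K) _).le
    calc _ ≤ ∑ P ∈ primes K z, (P.natDegree : ℝ) / qnorm P / 2 ^ (z / 2) := by
          refine Finset.sum_le_sum fun P hP => ?_
          have hP1 := mem_primes.1 hP
          have h0 : (1 : ℝ) ≤ P.natDegree := by exact_mod_cast hP1.2.1.natDegree_pos
          have hq := qnorm_pos P
          have h2 : qnorm P * 2 ^ (z / 2) ≤ qnorm (P ^ (z / P.natDegree + 1)) := by
            calc qnorm P * 2 ^ (z / 2) ≤
                  (Fintype.card K : ℝ) ^ P.natDegree * (Fintype.card K : ℝ) ^ (z / 2) :=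
                  mul_le_mul_of_nonneg_left
                    (pow_le_pow_left₀ zero_le_two (two_le_card_real K) _) hq.le
              _ = (Fintype.card K : ℝ) ^ (P.natDegree + z / 2) := (pow_add _ _ _).symm
              _ ≤ _ := by
                rw [qnorm, hP1.1.natDegree_pow]
                refine pow_le_pow_right₀ (one_lt_card_real K).le ?_
                have := hdeg P hP
                omega
          rw [div_div, inv_eq_one_div]
          exact div_le_div₀ (by positivity) h0 (by positivity) h2
      _ ≤ _ := by
        rw [← Finset.sum_div]
        exact div_le_div_of_nonneg_right (sum_natDegree_div_qnorm_le K z) (by positivity)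

/-- Here `b` is a smooth divisor of degree between `z` and `2 z`; Rankin's bound is applied to the
constant function 1 with `w = 5/4`. -/
theorem card_le_of_isCut_of_prime_le [Fintype K] {A : K[X]} {H z k : ℕ} (hH : 2 * z ≤ H)
    {S : Finset K[X]} (hS : S ⊆ ball A H)
    (hcut : ∀ F ∈ S, ∃ b c P, IsCut (2 * z) F b c P ∧ P.natDegree ≤ k ∧ z ≤ b.natDegree) :
    (S.card : ℝ) ≤ (Fintype.card K : ℝ) ^ H *
      (Real.exp 27 * ((5 / 4 : ℝ) ^ z)⁻¹ * Real.exp ((5 / 4 : ℝ) ^ k * k)) := by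
  classical
  refine (card_le_sum_of_dvd hS (φ := id)
    (D := (smoothOver (primes K k) (2 * z)).filter (z ≤ ·.natDegree)) ?_ ?_).trans ?_
  · intro b hb
    have hb := mem_smoothOver.1 (Finset.mem_filter.1 hb).1
    exact ⟨hb.1, hb.2.1.trans hH⟩
  · intro F hF
    obtain ⟨b, c, P, h, hPk, hbz⟩ := hcut F hF
    refine ⟨b, Finset.mem_filter.2 ⟨mem_smoothOver.2 ⟨h.monic_left, h.natDegree_le, ?_⟩, hbz⟩, ?_⟩
    · exact fun Q hQ hQ' hQb => mem_primes.2 ⟨hQ, hQ', (h.smooth Q hQ hQ' hQb).trans hPk⟩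
    · exact h.eq ▸ Dvd.intro _ rfl
  · refine mul_le_mul_of_nonneg_left ?_ (pow_pos (card_real_pos K) _).le
    have h1 := (IsShiuFunction.one (K := K)).sum_smooth_le (w := 5 / 4) (by norm_num)
      (by norm_num) le_rfl k z (2 * z)
    simp only [one_div, one_mul, mul_one] at h1
    refine h1.trans (mul_le_mul_of_nonneg_left (Real.exp_le_exp.2 ?_) (by positivity))
    calc _ ≤ ∑ P ∈ primes K k, (5 / 4 : ℝ) ^ k * ((P.natDegree : ℝ) / qnorm P) := by
          refine Finset.sum_le_sum fun P hP => ?_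
          have hP1 := mem_primes.1 hP
          have h0 : (1 : ℝ) ≤ P.natDegree := by exact_mod_cast hP1.2.1.natDegree_pos
          rw [← mul_div_assoc]
          refine div_le_div_of_nonneg_right ?_ (qnorm_pos P).le
          calc (5 / 4 : ℝ) ^ P.natDegree ≤ (5 / 4 : ℝ) ^ k * 1 := by
                rw [mul_one]; exact pow_le_pow_right₀ (by norm_num) hP1.2.2
            _ ≤ _ := mul_le_mul_of_nonneg_left h0 (by positivity)
      _ ≤ _ := by
        rw [← Finset.mul_sum]
        exact mul_le_mul_of_nonneg_left (sum_natDegree_div_qnorm_le K k) (by positivity)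

/-! ### The two main classes: sieve for `c`, Euler product for `b` -/

namespace IsShiuFunction

variable {δ A₁ A₂ : ℝ} {g : K[X] → ℝ}

/-- For fixed `b` the cofactors lie in a ball with `q ^ (H - deg b)` elements, still long enough to
sieve by primes of degree up to `m`. -/
theorem sum_le_of_factor [Fintype K] (hg : IsShiuFunction δ A₁ A₂ g) {A : K[X]} {H m : ℕ}
    {M : ℝ} (hM : 0 ≤ M) {B S : Finset K[X]} (hB : ∀ b ∈ B, b.Monic ∧ b.natDegree + 2 * m ≤ H)
    (hS : S ⊆ ball A H)
    (h : ∀ F ∈ S, ∃ b c, F = b * c ∧ b ∈ B ∧ c.Monic ∧ IsCoprime b c ∧ g c ≤ M ∧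
      ∀ P : K[X], P.Monic → Irreducible P → P.natDegree ≤ m → ¬ P ∣ c) :
    ∑ F ∈ S, g F ≤
      M * (2 * (Fintype.card K : ℝ) ^ H / (m + 1)) * ∑ b ∈ B, g b / qnorm b := by
  classical
  let R : K[X] → Finset K[X] := fun b => (ball (A /ₘ b) (H - b.natDegree)).filter fun c =>
    ∀ P : K[X], P.Monic → Irreducible P → P.natDegree ≤ m → ¬ P ∣ c
  have h1 : ∑ F ∈ S, g F ≤ ∑ y ∈ B.sigma R, g y.1 * M := by
    refine Finset.sum_le_sum_of_cover (fun y => y.1 * y.2) ?_ ?_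
    · intro F hF
      obtain ⟨b, c, rfl, hb, hc, hco, hM, hr⟩ := h F hF
      have hb' := hB b hb
      refine ⟨⟨b, c⟩, Finset.mem_sigma.2 ⟨hb, Finset.mem_filter.2 ⟨?_, hr⟩⟩, rfl, ?_⟩
      · exact (mul_mem_ball_iff hb'.1 (by omega)).1 (hS hF)
      · rw [hg.map_mul b c hb'.1 hc hco]
        exact mul_le_mul_of_nonneg_left hM (hg.nonneg b hb'.1)
    · rintro ⟨b, c⟩ hy
      exact mul_nonneg (hg.nonneg b (hB b (Finset.mem_sigma.1 hy).1).1) hM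
  rw [Finset.sum_sigma] at h1
  refine h1.trans ?_
  rw [Finset.mul_sum]
  refine Finset.sum_le_sum fun b hb => ?_
  obtain ⟨hbm, hbd⟩ := hB b hb
  have hgb := hg.nonneg b hbm
  have h2 : ((R b).card : ℝ) ≤ 2 * (Fintype.card K : ℝ) ^ (H - b.natDegree) / (m + 1) :=
    card_rough_le (by omega) (Finset.filter_subset _ _) fun c hc => (Finset.mem_filter.1 hc).2
  have h3 : (Fintype.card K : ℝ) ^ H = (Fintype.card K : ℝ) ^ (H - b.natDegree) * qnorm b := by
    rw [qnorm, ← pow_add]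
    congr 1
    omega
  have hq := qnorm_pos b
  dsimp only
  rw [Finset.sum_const, nsmul_eq_mul]
  calc _ ≤ 2 * (Fintype.card K : ℝ) ^ (H - b.natDegree) / (m + 1) * (g b * M) :=
        mul_le_mul_of_nonneg_right h2 (by positivity)
    _ = _ := by
      rw [h3]
      field_simp

/-- The sum over the primes in the exponential factor. -/
noncomputable def primeSum [Fintype K] (g : K[X] → ℝ) (N : ℕ) : ℝ :=
  ∑ P ∈ primes K N, g P / qnorm P

theorem sum_le_of_isCut_of_lt [Fintype K] (hg : IsShiuFunction δ A₁ A₂ g) (hδ : δ ≤ 1 / 48)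
    {a T : ℝ} (ha : 1 ≤ a) (hA₁ : 0 ≤ A₁) (ha₁ : A₁ ≤ a) {A : K[X]} {N H z : ℕ} (hz : 0 < z)
    (hT : (N : ℝ) ≤ T * z) (hH : 4 * z ≤ H) {S : Finset K[X]} (hS : S ⊆ ball A H)
    (hcut : ∀ F ∈ S, F.natDegree = N ∧ ∃ b c P, IsCut (2 * z) F b c P ∧ z < P.natDegree) :
    ∑ F ∈ S, g F ≤ a ^ T * (2 * (Fintype.card K : ℝ) ^ H / (z + 1)) *
      (Real.exp (27 * A₂) * Real.exp (primeSum g N)) := by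
  classical
  have hz' : (0 : ℝ) < z := Nat.cast_pos.2 hz
  have h1 := hg.sum_smooth_le hδ (w := 1) le_rfl (by norm_num) N 0 (2 * z)
  simp only [one_pow, mul_one, inv_one] at h1
  refine (hg.sum_le_of_factor (M := a ^ T) (m := z) (by positivity)
    (B := (smoothOver (primes K N) (2 * z)).filter (0 ≤ ·.natDegree)) ?_ hS ?_).trans
    (mul_le_mul_of_nonneg_left h1 (by have := card_real_pos K; positivity))
  · intro b hb
    have hb := mem_smoothOver.1 (Finset.mem_filter.1 hb).1
    exact ⟨hb.1, by omega⟩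
  · intro F hF
    obtain ⟨hN, b, c, P, h, hP⟩ := hcut F hF
    have hcN : c.natDegree ≤ N := hN ▸ h.natDegree_right_le
    refine ⟨b, c, h.eq, Finset.mem_filter.2
      ⟨mem_smoothOver.2 ⟨h.monic_left, h.natDegree_le, ?_⟩, Nat.zero_le _⟩,
      h.monic_right, h.coprime, ?_, ?_⟩
    · intro Q hQ hQ' hQb
      refine mem_primes.2 ⟨hQ, hQ', ?_⟩
      rw [← hN]
      have hF0 : F ≠ 0 := by
        rw [h.eq]; exact (h.monic_left.mul h.monic_right).ne_zero
      exact natDegree_le_of_dvd (h.eq ▸ hQb.mul_right c) hF0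
    · refine (hg.le_rpow_of_rough ha hA₁ ha₁ hz h.monic_right fun Q hQ hQ' hQc =>
        hP.le.trans (h.rough Q hQ hQ' hQc)).trans (Real.rpow_le_rpow_of_exponent_le ha ?_)
      rw [div_le_iff₀ hz']
      exact (Nat.cast_le.2 hcN).trans hT
    · intro Q hQ hQ' hQz hQc
      have := h.rough Q hQ hQ' hQc
      omega

/-- Twisting costs only a constant: by Bernoulli, `B ^ (deg P / k) ≤ 1 + (deg P / k) B`, and the
Chebyshev bound absorbs the extra term. -/
theorem sum_twist_le [Fintype K] (hg : IsShiuFunction δ A₁ A₂ g) (hA₁ : 0 ≤ A₁) {B : ℝ}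
    (hB : 1 ≤ B) {k N : ℕ} (hk : 0 < k) (hkN : k ≤ N) :
    ∑ P ∈ primes K k, g P * (B ^ (1 / k : ℝ)) ^ P.natDegree / qnorm P ≤
      primeSum g N + A₁ * B := by
  have hk' : (0 : ℝ) < k := Nat.cast_pos.2 hk
  have h1 : ∑ P ∈ primes K k, g P / qnorm P ≤ primeSum g N := by
    refine Finset.sum_le_sum_of_subset_of_nonneg (fun P hP => ?_) fun P hP _ =>
      div_nonneg (hg.nonneg P (mem_primes.1 hP).1) (qnorm_pos P).le
    have := mem_primes.1 hP
    exact mem_primes.2 ⟨this.1, this.2.1, this.2.2.trans hkN⟩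
  have h2 := sum_natDegree_div_qnorm_le K k
  calc _ ≤ ∑ P ∈ primes K k, (g P / qnorm P + A₁ * B / k * (P.natDegree / qnorm P)) := by
        refine Finset.sum_le_sum fun P hP => ?_
        obtain ⟨hP, hP', hPk⟩ := mem_primes.1 hP
        have hgP : g P ≤ A₁ := by simpa using hg.prime_pow_le P hP hP' 1 le_rfl
        have hg0 := hg.nonneg P hP
        have hPk' : (P.natDegree : ℝ) ≤ k := Nat.cast_le.2 hPk
        have h3 : (B ^ (1 / k : ℝ)) ^ P.natDegree ≤ 1 + P.natDegree / k * B := by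
          have := rpow_one_add_le_one_add_mul_self (s := B - 1) (by linarith)
            (p := P.natDegree / k) (by positivity) ((div_le_one hk').2 hPk')
          rw [add_sub_cancel] at this
          rw [← Real.rpow_natCast, ← Real.rpow_mul (by linarith), one_div_mul_eq_div]
          refine this.trans ?_
          gcongr
          linarith
        calc _ ≤ g P * (1 + P.natDegree / k * B) / qnorm P :=
              div_le_div_of_nonneg_right (mul_le_mul_of_nonneg_left h3 hg0) (qnorm_pos P).le
          _ = g P / qnorm P + g P * (B / k * (P.natDegree / qnorm P)) := by
            ring
          _ ≤ g P / qnorm P + A₁ * (B / k * (P.natDegree / qnorm P)) := by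
            have := (qnorm_pos P).le
            gcongr
          _ = _ := by ring
    _ = ∑ P ∈ primes K k, g P / qnorm P +
        A₁ * B / k * ∑ P ∈ primes K k, (P.natDegree / qnorm P : ℝ) := by
      rw [Finset.sum_add_distrib, Finset.mul_sum]
    _ ≤ primeSum g N + A₁ * B / k * k := by
      gcongr
    _ = _ := by rw [div_mul_cancel₀ _ hk'.ne']

/-- With `D = a ^ T`, the bound for `g c` costs `D ^ (r + 1)`, and sieving only to degree `z / (r +
1)` costs `r + 1`. Rankin's trick with `w = B ^ (1 / ⌊z / r⌋)` gains `B ^ r`, and `B = 4 D²` leaves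
`(1 / 2) ^ r`. -/
theorem sum_le_of_isCut_of_div_eq [Fintype K] (hg : IsShiuFunction δ A₁ A₂ g)
    (hδ : δ ≤ 1 / 48) {a T B : ℝ} (ha : 1 ≤ a) (hA₁ : 0 ≤ A₁) (ha₁ : A₁ ≤ a) (hT0 : 0 ≤ T)
    (hB : B = 4 * (a ^ T) ^ 2) {k₀ : ℕ} (hk₀ : B ≤ (5 / 4) ^ k₀) {A : K[X]} {N H z r : ℕ}
    (hz : 0 < z) (hr : 1 ≤ r) (hzN : z ≤ N)
    (hT : (N : ℝ) ≤ T * z) (hH : 4 * z ≤ H) {S : Finset K[X]} (hS : S ⊆ ball A H)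
    (hcut : ∀ F ∈ S, F.natDegree = N ∧ ∃ b c P, IsCut (2 * z) F b c P ∧ k₀ < P.natDegree ∧
      z / P.natDegree = r ∧ z ≤ b.natDegree) :
    ∑ F ∈ S, g F ≤ (1 / 2) ^ r * (2 * (Fintype.card K : ℝ) ^ H / z *
      (Real.exp (27 * A₂) * Real.exp (primeSum g N + A₁ * B))) := by
  classical
  have hq := card_real_pos K
  have hz' : (0 : ℝ) < z := Nat.cast_pos.2 hz
  have hD : 1 ≤ a ^ T := Real.one_le_rpow ha hT0
  set D := a ^ T with hDdef
  have hB1 : 1 ≤ B := by rw [hB]; nlinarith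
  rcases S.eq_empty_or_nonempty with rfl | ⟨F₀, hF₀⟩
  · rw [Finset.sum_empty]; positivity
  -- A member of `S` supplies `k₀ < deg P ≤ z / r`, which forces `w ≤ 5/4`; this is why the empty
  -- case is separated.
  have hk : k₀ < z / r := by
    obtain ⟨-, b, c, P, h, hP, rfl, -⟩ := hcut F₀ hF₀
    refine hP.trans_le ((Nat.le_div_iff_mul_le hr).2 ?_)
    exact Nat.mul_div_le z P.natDegree
  have hk0 : 0 < z / r := by omega
  have hk0' : (0 : ℝ) < (z / r : ℕ) := Nat.cast_pos.2 hk0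
  set w := B ^ (1 / (z / r : ℕ) : ℝ) with hw
  have hw1 : 1 ≤ w := Real.one_le_rpow hB1 (by positivity)
  have hw2 : w ≤ 5 / 4 := by
    calc w ≤ ((5 / 4 : ℝ) ^ (z / r)) ^ (1 / (z / r : ℕ) : ℝ) := by
          refine Real.rpow_le_rpow (by linarith) (hk₀.trans ?_) (by positivity)
          exact pow_le_pow_right₀ (by norm_num) hk.le
      _ = 5 / 4 := by
        rw [one_div, Real.pow_rpow_inv_natCast (by norm_num) (by omega)]
  have hwz : B ^ r ≤ w ^ z := by
    rw [hw, ← Real.rpow_natCast, ← Real.rpow_natCast, ← Real.rpow_mul (by linarith)]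
    refine Real.rpow_le_rpow_of_exponent_le hB1 ?_
    rw [one_div_mul_eq_div, le_div_iff₀ hk0']
    have := Nat.mul_div_le z r
    exact_mod_cast this
  have hS1 := hg.sum_smooth_le hδ hw1 hw2 (z / r) z (2 * z)
  have hS2 := hg.sum_twist_le hA₁ hB1 hk0 ((Nat.div_le_self z r).trans hzN)
  have hS3 : ∑ b ∈ (smoothOver (primes K (z / r)) (2 * z)).filter (z ≤ ·.natDegree),
      g b / qnorm b ≤
      Real.exp (27 * A₂) * (B ^ r)⁻¹ * Real.exp (primeSum g N + A₁ * B) := by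
    refine hS1.trans (mul_le_mul ?_ (Real.exp_le_exp.2 hS2) (by positivity) (by positivity))
    exact mul_le_mul_of_nonneg_left (inv_anti₀ (by positivity) hwz) (by positivity)
  have hmain := hg.sum_le_of_factor (M := D ^ (r + 1)) (m := z / (r + 1)) (by positivity)
    (B := (smoothOver (primes K (z / r)) (2 * z)).filter (z ≤ ·.natDegree)) ?_ hS ?_
  · refine (hmain.trans (mul_le_mul_of_nonneg_left hS3 (by positivity))).trans ?_
    have h1 : 2 * (Fintype.card K : ℝ) ^ H / ((z / (r + 1) : ℕ) + 1) ≤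
        2 * (Fintype.card K : ℝ) ^ H / z * (r + 1) := by
      have hpos : (0 : ℝ) < ((z / (r + 1) : ℕ) : ℝ) + 1 := by positivity
      have : z < (z / (r + 1) + 1) * (r + 1) :=
        Nat.lt_mul_of_div_lt (Nat.lt_succ_self _) (Nat.succ_pos r)
      have h' : (z : ℝ) < ((z / (r + 1) : ℕ) + 1) * (r + 1) := by exact_mod_cast this
      rw [div_mul_eq_mul_div, div_le_div_iff₀ hpos hz', mul_assoc (2 * (Fintype.card K : ℝ) ^ H)]
      exact mul_le_mul_of_nonneg_left (by linarith) (by positivity)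
    have h2 : D ^ (r + 1) * (r + 1) * (B ^ r)⁻¹ ≤ (1 / 2) ^ r := by
      have hr2 : (r + 1 : ℝ) ≤ 2 ^ r := by exact_mod_cast (Nat.lt_two_pow_self (n := r))
      have hD2 : D ^ (r + 1) ≤ (D ^ 2) ^ r := by
        rw [← pow_mul]
        exact pow_le_pow_right₀ hD (by omega)
      have hB2 : B ^ r = 2 ^ r * 2 ^ r * (D ^ 2) ^ r := by
        rw [hB, mul_pow, ← mul_pow (2 : ℝ)]
        norm_num
      rw [← div_eq_mul_inv, div_le_iff₀ (by positivity), hB2]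
      calc D ^ (r + 1) * (r + 1) ≤ (D ^ 2) ^ r * 2 ^ r := by gcongr
        _ = ((1 / 2) ^ r * 2 ^ r) * (2 ^ r * (D ^ 2) ^ r) := by
          rw [← mul_pow (1 / 2 : ℝ)]
          norm_num
          ring
        _ = _ := by ring
    calc _ ≤ D ^ (r + 1) * (2 * (Fintype.card K : ℝ) ^ H / z * (r + 1)) *
          (Real.exp (27 * A₂) * (B ^ r)⁻¹ * Real.exp (primeSum g N + A₁ * B)) := by
          gcongr
      _ = (D ^ (r + 1) * (r + 1) * (B ^ r)⁻¹) * (2 * (Fintype.card K : ℝ) ^ H / z *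
          (Real.exp (27 * A₂) * Real.exp (primeSum g N + A₁ * B))) := by ring
      _ ≤ _ := mul_le_mul_of_nonneg_right h2 (by positivity)
  · intro b hb
    have hb := mem_smoothOver.1 (Finset.mem_filter.1 hb).1
    have := Nat.div_le_self z (r + 1)
    exact ⟨hb.1, by omega⟩
  · intro F hF
    obtain ⟨hN, b, c, P, h, -, hPr, hbz⟩ := hcut F hF
    have hcN : c.natDegree ≤ N := hN ▸ h.natDegree_right_le
    have hP0 := h.irreducible.natDegree_pos
    have hzr : z < (r + 1) * P.natDegree :=
      Nat.lt_mul_of_div_lt (by omega) hP0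
    refine ⟨b, c, h.eq, Finset.mem_filter.2
      ⟨mem_smoothOver.2 ⟨h.monic_left, h.natDegree_le, ?_⟩, hbz⟩,
      h.monic_right, h.coprime, ?_, ?_⟩
    · intro Q hQ hQ' hQb
      refine mem_primes.2 ⟨hQ, hQ', (h.smooth Q hQ hQ' hQb).trans ?_⟩
      rw [Nat.le_div_iff_mul_le hr, ← hPr]
      exact Nat.mul_div_le z P.natDegree
    · refine (hg.le_rpow_of_rough ha hA₁ ha₁ hP0 h.monic_right h.rough).trans ?_
      rw [hDdef, ← Real.rpow_mul_natCast (by linarith)]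
      refine Real.rpow_le_rpow_of_exponent_le ha ?_
      rw [div_le_iff₀ (Nat.cast_pos.2 hP0), mul_assoc]
      refine (Nat.cast_le.2 hcN).trans (hT.trans (mul_le_mul_of_nonneg_left ?_ hT0))
      exact_mod_cast hzr.le
    · intro Q hQ hQ' hQz hQc
      have h1 := h.rough Q hQ hQ' hQc
      have h2 : z / (r + 1) < P.natDegree := by
        rw [Nat.div_lt_iff_lt_mul (Nat.succ_pos r), mul_comm]
        exact hzr
      omega

end IsShiuFunction

end

/-! ### Elementary estimates and assembly -/

theorem exists_natCast_pow_mul_pow_le (k : ℕ) {x : ℝ} (hx0 : 0 ≤ x) (hx : x < 1) :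
    ∃ c : ℝ, 0 ≤ c ∧ ∀ n : ℕ, (n : ℝ) ^ k * x ^ n ≤ c := by
  obtain ⟨c, hc⟩ := (tendsto_pow_const_mul_const_pow_of_abs_lt_one k
    (by rwa [abs_of_nonneg hx0] : |x| < 1)).bddAbove_range
  have h : ∀ n : ℕ, (n : ℝ) ^ k * x ^ n ≤ c := fun n => hc ⟨n, rfl⟩
  exact ⟨c, le_trans (by positivity) (h 0), h⟩

theorem two_rpow_le_pow {x : ℝ} {z : ℕ} (hx : x ≤ 5 / 24 * z) :
    (2 : ℝ) ^ x ≤ (7 / 6) ^ z := by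
  calc (2 : ℝ) ^ x ≤ 2 ^ (5 / 24 * z : ℝ) := Real.rpow_le_rpow_of_exponent_le one_le_two hx
    _ = ((2 : ℝ) ^ (5 : ℕ)) ^ (1 / 24 * z : ℝ) := by
      rw [← Real.rpow_natCast, ← Real.rpow_mul zero_le_two]
      congr 1
      push_cast
      ring
    _ ≤ ((7 / 6 : ℝ) ^ (24 : ℕ)) ^ (1 / 24 * z : ℝ) :=
      Real.rpow_le_rpow (by positivity) (by norm_num) (by positivity)
    _ = (7 / 6) ^ z := by
      rw [← Real.rpow_natCast, ← Real.rpow_mul (by norm_num), ← Real.rpow_natCast]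
      congr 1
      push_cast
      ring

theorem seven_fifths_pow_le (z : ℕ) : (7 / 5 : ℝ) ^ z ≤ 2 * 2 ^ (z / 2) := by
  have h : (7 / 5 : ℝ) ^ (2 * (z / 2)) ≤ 2 ^ (z / 2) := by
    rw [pow_mul]
    exact pow_le_pow_left₀ (by positivity) (by norm_num) _
  calc (7 / 5 : ℝ) ^ z ≤ (7 / 5 : ℝ) ^ (2 * (z / 2) + 1) :=
        pow_le_pow_right₀ (by norm_num) (by omega)
    _ ≤ 2 ^ (z / 2) * 2 := by
      rw [pow_succ]
      gcongr
      norm_num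
    _ = _ := mul_comm _ _

theorem polyInterval_subset_ball {K : Type*} [Field K] [Fintype K] (A : K[X]) (h : ℕ) :
    (polyInterval_finite A h).toFinset ⊆ ball A (h + 1) := by
  intro F hF
  have hF := ((Set.Finite.mem_toFinset _).1 hF).2.2
  rw [mem_ball_iff, ← neg_sub, degree_neg]
  exact hF.trans_lt (by exact_mod_cast Nat.lt_succ_self h)

theorem mainTheorem8 (β : ℝ) (hβ_pos : 0 < β) (hβ_lt : β < 1 / 2) :
    ∃ Nβ : ℕ, ∀ A₁ A₂ : ℝ, 0 < A₁ → 0 < A₂ →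
      ∃ C : ℝ, 0 < C ∧
        ∀ (K : Type*) [Field K] [Fintype K] (g : K[X] → ℝ),
          IsShiuFunction (β / 24) A₁ A₂ g →
          ∀ (N h : ℕ) (A : K[X]), Nβ ≤ N → A.Monic → A.natDegree = N →
            β * (N : ℝ) < (h : ℝ) → h + 1 ≤ N →
            ∑ F ∈ (polyInterval_finite A h).toFinset, g F ≤
              C * (((Fintype.card K : ℝ) ^ (h + 1) / (N : ℝ)) *
                Real.exp (∑ P ∈ (primesUpTo_finite K N).toFinset,
                  g P / (Fintype.card K : ℝ) ^ P.natDegree)) := by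
  -- With `β N ≥ 20`, the rounding in `z = ⌊h / 4⌋` still leaves `β N ≤ 5 z`.
  obtain ⟨N₀, hN₀⟩ := exists_nat_ge (20 / β)
  refine ⟨N₀, fun A₁ A₂ hA₁ hA₂ => ?_⟩
  obtain ⟨T, hT⟩ : ∃ T, T = 5 / β := ⟨_, rfl⟩
  obtain ⟨a, ha⟩ : ∃ a, a = max 1 A₁ := ⟨_, rfl⟩
  obtain ⟨B, hB⟩ : ∃ B, B = 4 * (a ^ T) ^ 2 := ⟨_, rfl⟩
  have hT0 : 0 < T := by rw [hT]; positivity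
  have ha1 : 1 ≤ a := ha ▸ le_max_left _ _
  have haA : A₁ ≤ a := ha ▸ le_max_right _ _
  obtain ⟨k₀, hk₀⟩ := pow_unbounded_of_one_lt B (by norm_num : (1 : ℝ) < 5 / 4)
  obtain ⟨c₁, hc₁0, hc₁⟩ := exists_natCast_pow_mul_pow_le 2 (x := 5 / 6) (by norm_num) (by norm_num)
  obtain ⟨c₂, hc₂0, hc₂⟩ :=
    exists_natCast_pow_mul_pow_le 1 (x := 14 / 15) (by norm_num) (by norm_num)
  -- One summand for each of the four cases; the outer `T` converts `1 / z` into `1 / N`.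
  refine ⟨T * (a ^ T * 2 * Real.exp (27 * A₂) + 2 * A₂ * c₁ +
    A₂ * c₂ * Real.exp 27 * Real.exp ((5 / 4 : ℝ) ^ k₀ * k₀) +
    4 * Real.exp (27 * A₂) * Real.exp (A₁ * B)), by positivity, ?_⟩
  intro K _ _ g hg N h A hN hA hAN hβh hhN
  classical
  have hδ : β / 24 ≤ 1 / 48 := by linarith
  have hNβ : 20 ≤ β * N := by
    have := hN₀.trans (Nat.cast_le.2 hN)
    rw [div_le_iff₀ hβ_pos] at this
    linarith
  -- A quarter of `h` leaves room for `deg b ≤ 2 z` and for sieving to degree `z`, which needs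
  -- another `2 z`.
  obtain ⟨z, hz⟩ : ∃ z, z = h / 4 := ⟨_, rfl⟩
  have hzh : (h : ℝ) < 4 * z + 4 := by
    have : h < 4 * z + 4 := by omega
    exact_mod_cast this
  have hNz5 : β * N ≤ 5 * z := by linarith
  have hz0' : (0 : ℝ) < z := by linarith
  have hz0 : 0 < z := Nat.cast_pos.1 hz0'
  have hNz : (N : ℝ) ≤ T * z := by
    rw [hT, div_mul_eq_mul_div, le_div_iff₀ hβ_pos]
    linarith
  have hN0 : (0 : ℝ) < N := Nat.cast_pos.2 (by omega)
  have hq := card_real_pos K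
  change _ ≤ _ * (((Fintype.card K : ℝ) ^ (h + 1) / (N : ℝ)) *
    Real.exp (IsShiuFunction.primeSum g N))
  set Q := (Fintype.card K : ℝ) ^ (h + 1) with hQ
  have hQ0 : 0 < Q := pow_pos hq _
  set E := Real.exp (IsShiuFunction.primeSum g N) with hE
  -- The exceptional cases produce no exponential factor; it is inserted by `1 ≤ E`.
  have hE1 : 1 ≤ E := Real.one_le_exp (Finset.sum_nonneg fun P hP =>
    div_nonneg (hg.nonneg P (mem_primes.1 hP).1) (qnorm_pos P).le)
  set Y := Q / N * E with hY
  have hY0 : 0 ≤ Y := by positivity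
  have hQzE : Q / z * E ≤ T * Y := by
    rw [hY, ← mul_assoc, ← mul_div_assoc]
    refine mul_le_mul_of_nonneg_right ?_ (by positivity)
    rw [div_le_div_iff₀ hz0' hN0]
    nlinarith
  have hQz : Q / z ≤ T * Y :=
    (le_mul_of_one_le_right (by positivity) hE1).trans hQzE
  set I := (polyInterval_finite A h).toFinset with hI
  have hIb : I ⊆ ball A (h + 1) := polyInterval_subset_ball A h
  have hImem : ∀ F ∈ I, F.Monic ∧ F.natDegree = N := fun F hF => by
    have := (Set.Finite.mem_toFinset _).1 hF
    exact ⟨this.1, this.2.1.trans hAN⟩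
  -- The base `7/6` lies below both savings, `√2` (through `7/5`) and `5/4`; the quotients are `5/6`
  -- and `14/15`.
  have htriv : ∀ F ∈ I, g F ≤ A₂ * (7 / 6) ^ z := fun F hF => by
    refine (hg.le_two_rpow F (hImem F hF).1).trans (mul_le_mul_of_nonneg_left ?_ hA₂.le)
    refine two_rpow_le_pow ?_
    rw [(hImem F hF).2]
    linarith
  let p₁ : K[X] → Prop := fun F => ∃ b c P, IsCut (2 * z) F b c P ∧ z < P.natDegree
  let p₂ : K[X] → Prop := fun F =>
    ∃ b c P, IsCut (2 * z) F b c P ∧ P.natDegree ≤ z ∧ b.natDegree ≤ z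
  let p₃ : K[X] → Prop := fun F =>
    ∃ b c P, IsCut (2 * z) F b c P ∧ P.natDegree ≤ k₀ ∧ z ≤ b.natDegree
  let p₄ : ℕ → K[X] → Prop := fun r F => ∃ b c P, IsCut (2 * z) F b c P ∧
    k₀ < P.natDegree ∧ z / P.natDegree = r ∧ z ≤ b.natDegree
  have hsplit : ∑ F ∈ I, g F ≤ ∑ F ∈ I.filter p₁, g F + ∑ F ∈ I.filter p₂, g F +
      ∑ F ∈ I.filter p₃, g F + ∑ r ∈ Finset.Icc 1 z, ∑ F ∈ I.filter (p₄ r), g F := by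
    simp_rw [Finset.sum_filter]
    rw [Finset.sum_comm, ← Finset.sum_add_distrib, ← Finset.sum_add_distrib,
      ← Finset.sum_add_distrib]
    refine Finset.sum_le_sum fun F hF => ?_
    have hgF := hg.nonneg F (hImem F hF).1
    have hite : ∀ p : Prop, 0 ≤ if p then g F else 0 := fun p => by
      split_ifs
      exacts [hgF, le_rfl]
    have h4 : 0 ≤ ∑ r ∈ Finset.Icc 1 z, if p₄ r F then g F else 0 :=
      Finset.sum_nonneg fun r _ => hite _
    have h1 := hite (p₁ F)
    have h2 := hite (p₂ F)
    have h3 := hite (p₃ F)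
    obtain ⟨b, c, P, hcut⟩ := exists_isCut (Z := 2 * z) (hImem F hF).1
      (by rw [(hImem F hF).2]; omega)
    by_cases hP : z < P.natDegree
    · rw [if_pos (show p₁ F from ⟨b, c, P, hcut, hP⟩)]
      linarith
    rw [not_lt] at hP
    rcases le_total b.natDegree z with hb | hb
    · rw [if_pos (show p₂ F from ⟨b, c, P, hcut, hP, hb⟩)]
      linarith
    rcases le_or_gt P.natDegree k₀ with hk | hk
    · rw [if_pos (show p₃ F from ⟨b, c, P, hcut, hk, hb⟩)]
      linarith
    · have hr : z / P.natDegree ∈ Finset.Icc 1 z := Finset.mem_Icc.2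
        ⟨(Nat.one_le_div_iff hcut.irreducible.natDegree_pos).2 hP, Nat.div_le_self _ _⟩
      have h5 := Finset.single_le_sum (f := fun r => if p₄ r F then g F else 0)
        (fun r _ => hite _) hr
      rw [if_pos (show p₄ _ F from ⟨b, c, P, hcut, hk, rfl, hb⟩)] at h5
      linarith
  have b₁ : ∑ F ∈ I.filter p₁, g F ≤ a ^ T * 2 * Real.exp (27 * A₂) * (T * Y) := by
    have := hg.sum_le_of_isCut_of_lt hδ ha1 hA₁.le haA hz0 hNz (by omega : 4 * z ≤ h + 1)
      ((Finset.filter_subset p₁ I).trans hIb) fun F hF =>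
        ⟨(hImem F (Finset.mem_filter.1 hF).1).2, (Finset.mem_filter.1 hF).2⟩
    refine this.trans ?_
    calc _ ≤ a ^ T * (2 * Q / z) * (Real.exp (27 * A₂) * E) := by
          gcongr
          linarith
      _ = a ^ T * 2 * Real.exp (27 * A₂) * (Q / z * E) := by ring
      _ ≤ _ := mul_le_mul_of_nonneg_left hQzE (by positivity)
  have hcard : ∀ (p : K[X] → Prop) (x : ℝ), ((I.filter p).card : ℝ) ≤ Q * x →
      ∑ F ∈ I.filter p, g F ≤ A₂ * (Q * ((7 / 6) ^ z * x)) := by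
    intro p x hx
    calc ∑ F ∈ I.filter p, g F ≤ ∑ F ∈ I.filter p, A₂ * (7 / 6) ^ z :=
          Finset.sum_le_sum fun F hF => htriv F (Finset.mem_filter.1 hF).1
      _ = (I.filter p).card * (A₂ * (7 / 6) ^ z) := by rw [Finset.sum_const, nsmul_eq_mul]
      _ ≤ Q * x * (A₂ * (7 / 6) ^ z) := mul_le_mul_of_nonneg_right hx (by positivity)
      _ = _ := by ring
  have b₂ : ∑ F ∈ I.filter p₂, g F ≤ 2 * A₂ * c₁ * (T * Y) := by
    refine (hcard p₂ _ (card_le_of_isCut_of_le (by omega)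
      ((Finset.filter_subset p₂ I).trans hIb) fun F hF => (Finset.mem_filter.1 hF).2)).trans ?_
    have h1 : (7 / 6 : ℝ) ^ z * (z / 2 ^ (z / 2)) ≤ 2 * (c₁ / z) := by
      have h75 := seven_fifths_pow_le z
      have h56 : (7 / 6 : ℝ) ^ z = (5 / 6) ^ z * (7 / 5) ^ z := by
        rw [← mul_pow]
        norm_num
      rw [h56, ← mul_div_assoc, ← mul_div_assoc, div_le_div_iff₀ (by positivity) hz0']
      calc _ = (z : ℝ) ^ 2 * (5 / 6) ^ z * (7 / 5) ^ z := by ring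
        _ ≤ c₁ * (2 * 2 ^ (z / 2)) := mul_le_mul (hc₁ z) h75 (by positivity) hc₁0
        _ = _ := by ring
    calc _ ≤ A₂ * (Q * (2 * (c₁ / z))) := by gcongr
      _ = 2 * A₂ * c₁ * (Q / z) := by ring
      _ ≤ _ := mul_le_mul_of_nonneg_left hQz (by positivity)
  have b₃ : ∑ F ∈ I.filter p₃, g F ≤
      A₂ * c₂ * Real.exp 27 * Real.exp ((5 / 4 : ℝ) ^ k₀ * k₀) * (T * Y) := by
    refine (hcard p₃ _ (card_le_of_isCut_of_prime_le (by omega)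
      ((Finset.filter_subset p₃ I).trans hIb) fun F hF => (Finset.mem_filter.1 hF).2)).trans ?_
    have h1 : (7 / 6 : ℝ) ^ z * ((5 / 4 : ℝ) ^ z)⁻¹ ≤ c₂ / z := by
      rw [le_div_iff₀ hz0', ← div_eq_mul_inv, ← div_pow]
      refine le_trans (le_of_eq ?_) (hc₂ z)
      norm_num
      ring
    calc _ = A₂ * (Q * ((7 / 6 : ℝ) ^ z * ((5 / 4 : ℝ) ^ z)⁻¹)) *
          (Real.exp 27 * Real.exp ((5 / 4 : ℝ) ^ k₀ * k₀)) := by ring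
      _ ≤ A₂ * (Q * (c₂ / z)) * (Real.exp 27 * Real.exp ((5 / 4 : ℝ) ^ k₀ * k₀)) := by gcongr
      _ = A₂ * c₂ * Real.exp 27 * Real.exp ((5 / 4 : ℝ) ^ k₀ * k₀) * (Q / z) := by ring
      _ ≤ _ := mul_le_mul_of_nonneg_left hQz (by positivity)
  have b₄ : ∑ r ∈ Finset.Icc 1 z, ∑ F ∈ I.filter (p₄ r), g F ≤
      4 * Real.exp (27 * A₂) * Real.exp (A₁ * B) * (T * Y) := by
    have h1 : ∀ r ∈ Finset.Icc 1 z, ∑ F ∈ I.filter (p₄ r), g F ≤ (1 / 2) ^ r * (2 * Q / z *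
        (Real.exp (27 * A₂) * Real.exp (IsShiuFunction.primeSum g N + A₁ * B))) := by
      intro r hr
      exact hg.sum_le_of_isCut_of_div_eq hδ ha1 hA₁.le haA hT0.le hB hk₀.le hz0
        (Finset.mem_Icc.1 hr).1 (by omega) hNz (by omega : 4 * z ≤ h + 1)
        ((Finset.filter_subset (p₄ r) I).trans hIb) fun F hF =>
          ⟨(hImem F (Finset.mem_filter.1 hF).1).2, (Finset.mem_filter.1 hF).2⟩
    have h2 : ∑ r ∈ Finset.Icc 1 z, (1 / 2 : ℝ) ^ r ≤ 2 := by
      refine (Finset.sum_le_sum_of_subset_of_nonneg (t := Finset.range (z + 1)) ?_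
        fun _ _ _ => by positivity).trans
          ((sum_geometric_le (by norm_num) (by norm_num) _).trans_eq (by norm_num))
      intro r hr
      have := Finset.mem_Icc.1 hr
      exact Finset.mem_range.2 (by omega)
    refine (Finset.sum_le_sum h1).trans ?_
    rw [← Finset.sum_mul, Real.exp_add, ← hE]
    calc _ ≤ 2 * (2 * Q / z * (Real.exp (27 * A₂) * (E * Real.exp (A₁ * B)))) := by gcongr
      _ = 4 * Real.exp (27 * A₂) * Real.exp (A₁ * B) * (Q / z * E) := by ring
      _ ≤ _ := by
        refine mul_le_mul_of_nonneg_left hQzE ?_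
        positivity
  linarith
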